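/- **Setting.** Let $(\mathcal S,\mathcal A,p,r,\mu)$ be a finite MDP with sink state $e$: $p(e,a,e)=1$, $r(e,a,e)=0$ for all $a\in\mathcal A\ne\emptyset$, and $\mu(e)=0$. Let $\Pi=\mathcal A^{\mathcal S}$ be the set of stationary deterministic policies, and assume the MDP is transient: $\sum_{t\ge 0}\mathbb P^{\pi,s}[\tilde s_t=s']<\infty$ for all $\pi\in\Pi$ and $s,s'\in\mathcal S\setminus\{e\}$. Write $X_t=\sum_{k<t}r(\tilde s_k,\tilde a_k,\tilde s_{k+1})$, $\mathrm{ERM}_\beta[X]=-\beta^{-1}\log\mathbb E\,e^{-\beta X}$, $\mathrm{EVaR}_\alpha[X]=\sup_{\beta>0}(\mathrm{ERM}_\beta[X]+\beta^{-1}\log\alpha)$, and $$h(\pi,\beta)=\lim_{t\to\infty}\mathrm{ERM}_\beta^{\pi,\mu}[X_t]+\beta^{-1}\log\alpha\in[-\infty,\infty),\qquad h^\star(\beta)=\max_{\pi\in\Pi}h(\pi,\beta).$$ **Grid.** For $\alpha\in(0,1)$, $\delta>0$, $\beta_0>0$ let $\mathcal B(\beta_0,\delta)=\{\beta_0,\dots,\beta_K\}$,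 where $\beta_{k+1}=\beta_k\log\frac1\alpha\,/\,(\log\frac1\alpha-\beta_k\delta)$ and $K$ is the least index with $\beta_K\ge\delta^{-1}\log\frac1\alpha$. **Algorithm.** Given a stream of samples $(\tilde s_i,\tilde a_i,\tilde s'_i)$, step sizes $\tilde\eta_i$ $(i\in\mathbb N)$ and bounds $z_{\min}(\beta),z_{\max}(\beta)\in\mathbb R$, ERM Q-learning for the risk level $\beta$ starts from $\tilde q_0(\cdot,\cdot,\beta)=0$. At step $i$ it computes the TD residual $\tilde z_i(\beta)=r(\tilde s_i,\tilde a_i,\tilde s'_i)+\max_{a'}\tilde q_i(\tilde s'_i,a',\beta)-\tilde q_i(\tilde s_i,\tilde a_i,\beta)$. If $\tilde z_i(\beta)\notin[z_{\min}(\beta),z_{\max}(\beta)]$ it stops and returns $-\infty$; otherwise it sets $\tilde q_{i+1}(\tilde s_i,\tilde a_i,\beta)=\tilde q_i(\tilde s_i,\tilde a_i,\beta)-\tilde\eta_i(e^{-\beta\tilde z_i(\beta)}-1)$ and leaves all other entries unchanged. EVaR Q-learning runs this for every $\beta\in\mathcal B(\beta_0,\delta)$ on the same stream. From estimates $q(\cdot,\cdot,\beta)$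 it forms $\hat h(\beta)=\mathrm{ERM}_\beta^{\mu}[\max_a q(\tilde s_0,a,\beta)]+\beta^{-1}\log\alpha$ (with $\hat h(\beta)=-\infty$ if the run returned $-\infty$), picks a maximizer $\hat\beta$ of $\hat h$ over $\mathcal B(\beta_0,\delta)$, and outputs a policy $\pi$ with $\pi(s)\in\arg\max_a q(s,a,\hat\beta)$ for all $s$ (an arbitrary policy if the run for $\hat\beta$ returned $-\infty$). Ties are broken arbitrarily. **Theorem.** For every such MDP, $\alpha\in(0,1)$ and $\delta>0$ there is $\bar\beta>0$ such that the following holds for every $\beta_0\in(0,\bar\beta]$. Assume that almost surely: 1. for all $i\in\mathbb N$ and $s'\in\mathcal S$, $\mathbb P[\tilde s'_i=s'\mid \tilde s_i,\tilde a_i,\tilde\eta_i,(\tilde\eta_l,\tilde s_l,\tilde a_l,\tilde s'_l)_{l<i}]=p(\tilde s_i,\tilde a_i,s')$; 2. $\tilde\eta_i\ge 0$ for all $i$, and for all $s\in\mathcal S\setminus\{e\}$, $a\in\mathcal A$: $\sum_{i:(\tilde s_i,\tilde a_i)=(s,a)}\tilde\eta_i=\infty$ and $\sum_{i:(\tilde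 s_i,\tilde a_i)=(s,a)}\tilde\eta_i^2<\infty$; 3. for every $\beta\in\mathcal B(\beta_0,\delta)$ with $h^\star(\beta)>-\infty$, $\tilde z_i(\beta)\in[z_{\min}(\beta),z_{\max}(\beta)]$ for all $i$. Then, almost surely: * for every $\beta\in\mathcal B(\beta_0,\delta)$, the run for $\beta$ either never stops and $\tilde q_i(\cdot,\cdot,\beta)$ converges to a finite limit $q_\infty(\cdot,\cdot,\beta)$, or it returns $-\infty$ after finitely many steps; in both cases the resulting limit value of $\hat h(\beta)$ equals $h^\star(\beta)$; * every policy that EVaR Q-learning outputs from these limits is $\delta$-optimal, and for all sufficiently large $i$ every policy that it outputs from the iterates $\tilde q_i$ is $\delta$-optimal. Here $\pi^\star\in\Pi$ is $\delta$-optimal if $\lim_{t\to\infty}\mathrm{EVaR}_\alpha^{\pi,\mu}[X_t]$ exists and is finite for every $\pi\in\Pi$, and $\lim_{t\to\infty}\mathrm{EVaR}_\alpha^{\pi^\star,\mu}[X_t]\ \ge\ \max_{\pi\in\Pi}\lim_{t\to\infty}\mathrm{EVaR}_\alpha^{\pi,\mu}[X_t]-\delta.$ -/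

import Mathlib

open MeasureTheory Filter Topology

noncomputable section

namespace TRC

/-- A finite Markov decision process with a reward-free absorbing sink state `sink`
that carries no initial mass. -/
structure MDP (S A : Type*) [Fintype S] where
  p : S → A → S → ℝ
  r : S → A → S → ℝ
  μ : S → ℝ
  sink : S
  p_nonneg : ∀ s a s', 0 ≤ p s a s'
  p_sum : ∀ s a, ∑ s', p s a s' = 1
  μ_nonneg : ∀ s, 0 ≤ μ s
  μ_sum : ∑ s, μ s = 1
  p_sink : ∀ a, p sink a sink = 1
  r_sink : ∀ a, r sink a sink = 0
  μ_sink : μ sink = 0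

/-- Entropic risk measure of the random variable `X` on a finite set with probability
weights `w`. -/
def erm {X : Type*} [Fintype X] (w : X → ℝ) (β : ℝ) (f : X → ℝ) : ℝ :=
  -β⁻¹ * Real.log (∑ x, w x * Real.exp (-β * f x))

/-- Entropic value-at-risk, as a supremum in the extended reals. -/
def evar {X : Type*} [Fintype X] (w : X → ℝ) (α : ℝ) (f : X → ℝ) : EReal :=
  ⨆ (β : ℝ) (_ : 0 < β), ((erm w β f + β⁻¹ * Real.log α : ℝ) : EReal)

section Model

variable {S A : Type*} [Fintype S]

/-- Law of the first `t + 1` states of the chain that the stationary deterministic policy `π`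
induces from the initial distribution `ν`. -/
def pathLaw (M : MDP S A) (π : S → A) (ν : S → ℝ) (t : ℕ) (x : Fin (t + 1) → S) : ℝ :=
  ν (x 0) * ∏ k : Fin t, M.p (x k.castSucc) (π (x k.castSucc)) (x k.succ)

/-- Reward collected in the first `t` steps along a path. -/
def pathReward (M : MDP S A) (π : S → A) (t : ℕ) (x : Fin (t + 1) → S) : ℝ :=
  ∑ k : Fin t, M.r (x k.castSucc) (π (x k.castSucc)) (x k.succ)

/-- `P^{π,s}[s_t = s']`. -/
def stateProb [DecidableEq S] (M : MDP S A) (π : S → A) (s : S) (t : ℕ) (s' : S) : ℝ :=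
  ∑ x : Fin (t + 1) → S,
    if x (Fin.last t) = s' then pathLaw M π (Pi.single s 1) t x else 0

/-- Every stationary deterministic policy has finite expected occupation of every pair of
non-sink states. -/
def Transient [DecidableEq S] (M : MDP S A) : Prop :=
  ∀ π : S → A, ∀ s s' : S, s ≠ M.sink → s' ≠ M.sink →
    Summable fun t : ℕ => stateProb M π s t s'

/-- `t`-step EVaR objective of a policy. -/
def evarReturn (M : MDP S A) (α : ℝ) (π : S → A) (t : ℕ) : EReal :=
  evar (pathLaw M π M.μ t) α (pathReward M π t)

/-- ERM total-reward objective. The limit over the horizon always exists in `[-∞, ∞)` for the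
models considered; it is written as a `liminf` to have a total definition. -/
def ermTotal (M : MDP S A) (β : ℝ) (π : S → A) : EReal :=
  liminf (fun t : ℕ => ((erm (pathLaw M π M.μ t) β (pathReward M π t) : ℝ) : EReal)) atTop

/-- `h(π, β)`. -/
def hVal (M : MDP S A) (α : ℝ) (π : S → A) (β : ℝ) : EReal :=
  ermTotal M β π + ((β⁻¹ * Real.log α : ℝ) : EReal)

/-- `h⋆(β) = max_π h(π, β)`. -/
def hStar (M : MDP S A) (α β : ℝ) : EReal :=
  ⨆ π : S → A, hVal M α π β

/-- For every policy the EVaR total-reward objective exists as a finite limit, and the value of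
`π` is within `δ` of the value of every stationary policy. -/
def DeltaOptimal (M : MDP S A) (α δ : ℝ) (π : S → A) : Prop :=
  ∃ V : (S → A) → ℝ,
    (∀ π' : S → A, Tendsto (evarReturn M α π') atTop (𝓝 ((V π' : ℝ) : EReal))) ∧
    ∀ π' : S → A, V π' - δ ≤ V π

end Model

/-- The points `β_k` of the discretization of the risk level. -/
def gridPt (α δ β₀ : ℝ) : ℕ → ℝ
  | 0 => β₀
  | k + 1 => gridPt α δ β₀ k * Real.log (1 / α) /
      (Real.log (1 / α) - gridPt α δ β₀ k * δ)

/-- The least index `K` with `β_K ≥ log (1/α) / δ`. -/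
def gridLast (α δ β₀ : ℝ) : ℕ :=
  sInf {k : ℕ | Real.log (1 / α) / δ ≤ gridPt α δ β₀ k}

/-- The grid `{β_0, …, β_K}`. -/
def grid (α δ β₀ : ℝ) : Finset ℝ :=
  (Finset.range (gridLast α δ β₀ + 1)).image (gridPt α δ β₀)

section Algorithm

variable {S A : Type*} [Fintype S] [Fintype A] [Nonempty A]

/-- `max_a q(s, a)`. -/
def maxQ (q : S → A → ℝ) (s : S) : ℝ :=
  Finset.univ.sup' Finset.univ_nonempty (q s)

/-- TD residual of the transition `(s, a, s')`. -/
def tdResidual (M : MDP S A) (q : S → A → ℝ) (s : S) (a : A) (s' : S) : ℝ :=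
  M.r s a s' + maxQ q s' - q s a

open Classical in
/-- One step of ERM Q-learning; the value `none` means that the run has returned `-∞` since a
TD residual left `[zmin, zmax]`. -/
def qStep (M : MDP S A) (β zmin zmax η : ℝ) (s : S) (a : A) (s' : S) :
    Option (S → A → ℝ) → Option (S → A → ℝ)
  | none => none
  | some q =>
      if zmin ≤ tdResidual M q s a s' ∧ tdResidual M q s a s' ≤ zmax then
        some fun x b =>
          if x = s ∧ b = a then
            q x b - η * (Real.exp (-β * tdResidual M q s a s') - 1)
          else q x b
      else none

/-- The ERM Q-learning iterates for one risk level `β` on a stream of samples. -/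
def qIter (M : MDP S A) (β zmin zmax : ℝ) (η : ℕ → ℝ) (s : ℕ → S) (a : ℕ → A) (s' : ℕ → S) :
    ℕ → Option (S → A → ℝ)
  | 0 => some fun _ _ => 0
  | i + 1 => qStep M β zmin zmax (η i) (s i) (a i) (s' i) (qIter M β zmin zmax η s a s' i)

/-- The estimate of `h⋆(β)` obtained from an estimate of the state-action values. -/
def hEst (M : MDP S A) (α β : ℝ) : Option (S → A → ℝ) → EReal
  | none => ⊥
  | some q => ((erm M.μ β (maxQ q) + β⁻¹ * Real.log α : ℝ) : EReal)

/-- `π` is greedy with respect to the estimate (any policy, if the run returned `-∞`). -/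
def Greedy : Option (S → A → ℝ) → (S → A) → Prop
  | none, _ => True
  | some q, π => ∀ s a, q s a ≤ q s (π s)

/-- `π` is a possible output of EVaR Q-learning, given the estimates `Q β` for the risk levels
`β` in `B`: it is greedy for a risk level that maximizes the estimate of `h⋆` over `B`. -/
def EvarOutput (M : MDP S A) (α : ℝ) (B : Finset ℝ) (Q : ℝ → Option (S → A → ℝ))
    (π : S → A) : Prop :=
  ∃ β ∈ B, (∀ β' ∈ B, hEst M α β' (Q β') ≤ hEst M α β (Q β)) ∧ Greedy (Q β) π

/-- Convergence of a run: it never stops and its values converge to the given ones, or it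
has returned `-∞` from some time on. -/
def RunConverges (run : ℕ → Option (S → A → ℝ)) : Option (S → A → ℝ) → Prop
  | none => ∀ᶠ i in atTop, run i = none
  | some q => ∃ qs : ℕ → S → A → ℝ, (∀ i, run i = some (qs i)) ∧ Tendsto qs atTop (𝓝 q)

end Algorithm

section Sampling

variable {S A Ω : Type*}

/-- The σ-algebra generated by `η_i`, `s_i`, `a_i` and by `η_l`, `s_l`, `a_l`, `s'_l`
for `l < i`. -/
abbrev history (η : ℕ → Ω → ℝ) (s : ℕ → Ω → S) (a : ℕ → Ω → A) (s' : ℕ → Ω → S) (i : ℕ) :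
    MeasurableSpace Ω :=
  (MeasurableSpace.comap (η i) inferInstance ⊔ MeasurableSpace.comap (s i) ⊤ ⊔
      MeasurableSpace.comap (a i) ⊤) ⊔
    ⨆ l : Fin i, (MeasurableSpace.comap (η l) inferInstance ⊔ MeasurableSpace.comap (s l) ⊤ ⊔
      MeasurableSpace.comap (a l) ⊤ ⊔ MeasurableSpace.comap (s' l) ⊤)

/-- The stream of samples and step sizes consists of random variables, and the next state of
each sample is drawn from the transition probabilities given the past. -/
structure IsSampleStream [mΩ : MeasurableSpace Ω] [Fintype S] (M : MDP S A) (P : Measure Ω)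
    (η : ℕ → Ω → ℝ) (s : ℕ → Ω → S) (a : ℕ → Ω → A) (s' : ℕ → Ω → S) : Prop where
  measurable_step : ∀ i, Measurable (η i)
  measurable_state : ∀ i, Measurable[mΩ, ⊤] (s i)
  measurable_action : ∀ i, Measurable[mΩ, ⊤] (a i)
  measurable_next : ∀ i, Measurable[mΩ, ⊤] (s' i)
  transition : ∀ i, ∀ x : S,
    P[Set.indicator {ω | s' i ω = x} (fun _ => (1 : ℝ)) | history η s a s' i]
      =ᵐ[P] fun ω => M.p (s i ω) (a i ω) x

open Classical in
/-- Robbins–Monro conditions along the visits of every state-action pair (non-sink state). -/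
def RobbinsMonro [MeasurableSpace Ω] [Fintype S] (M : MDP S A) (P : Measure Ω)
    (η : ℕ → Ω → ℝ) (s : ℕ → Ω → S) (a : ℕ → Ω → A) : Prop :=
  ∀ᵐ ω ∂P, (∀ i, 0 ≤ η i ω) ∧ ∀ x : S, x ≠ M.sink → ∀ b : A,
    ¬ Summable (fun i => if s i ω = x ∧ a i ω = b then η i ω else 0) ∧
    Summable (fun i => if s i ω = x ∧ a i ω = b then η i ω ^ 2 else 0)

end Sampling

end TRC

end

/-! Exponentiation makes ERM linear: for a policy `π` the moment `E exp(-β X_t)` is `μ · K^t 1`,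
where `K` is `expMatrix M β π`. Transience gives finite absorption times, hence a set of states
closed under a policy contains the sink (`sink_mem_of_closed`). The weight absorbed in the sink
increases with `t`; it diverges, which makes the ERM tend to `-∞`, or it converges and the weight
outside the sink dies out (`weight_dichotomy`).

Grid: ERM is antitone in `β` and the reciprocals `1/β_k` decrease in steps of `δ / log (1/α)`, so
moving a level `β ≥ β₀` down to the grid costs at most `δ`. The ERM is bounded above uniformly in
`β` and `t`, so levels below a small `β₀` cannot compete, as `β⁻¹ log α → -∞`. This cover is uniform
in `t`. It therefore also interchanges the limit in `t` with the supremum over `β`, and a policy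
attaining the grid maximum of `h⋆` is `δ`-optimal (`exists_grid_deltaOptimal`).

Q-values: with `w = exp(-β max_a q)` the fixed-point equation becomes the exponential Bellman
equation. A comparison principle (`le_of_bellman_le`) replaces contraction: where the ratio of a
subsolution to a supersolution is maximal and exceeds 1, it stays maximal along successors up to the
sink, where the boundary values forbid it. Every solution yields `h⋆`, attained by its greedy
policies.

Learning: no solution is constructed beforehand. If a run never stops, its sampled residuals are
bounded; a conditional Borel–Cantelli argument extends the bounds to all possible transitions, the
iterates are then bounded because unboundedness would spread to the sink, and the noise is a
convergent martingale transform. The limsup and liminf of the iterates satisfy opposite Bellman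
inequalities, so comparison makes them equal. Thus a run that never stops has a limit solving the
Bellman equation, while stopping forces `h⋆ = -∞` by the residual hypothesis. As the grid and the
action set are finite, outputs from late iterates are outputs from the limits. -/

namespace TRC

/-! ### Path sums as matrix powers, and absorption times. -/

section PathSums

open Matrix

variable {S A : Type*} [Fintype S]

theorem pathLaw_nonneg (M : MDP S A) (π : S → A) (t : ℕ) (x : Fin (t + 1) → S) :
    0 ≤ pathLaw M π M.μ t x :=
  mul_nonneg (M.μ_nonneg _) (Finset.prod_nonneg fun _ _ => M.p_nonneg _ _ _)

theorem p_sink_of_ne (M : MDP S A) (a : A) {s : S} (hs : s ≠ M.sink) : M.p M.sink a s = 0 := by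
  classical
  have h := M.p_sum M.sink a
  rw [← Finset.add_sum_erase _ _ (Finset.mem_univ M.sink), M.p_sink, add_eq_left,
    Finset.sum_eq_zero_iff_of_nonneg fun i _ => M.p_nonneg _ _ _] at h
  exact h s (Finset.mem_erase.2 ⟨hs, Finset.mem_univ s⟩)

theorem sum_p_sink_mul (M : MDP S A) (a : A) (f : S → ℝ) :
    ∑ s, M.p M.sink a s * f s = f M.sink := by
  rw [Finset.sum_eq_single M.sink (fun s _ hs => by rw [p_sink_of_ne M a hs, zero_mul]) (by simp),
    M.p_sink, one_mul]

variable [DecidableEq S]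

/-- Transition matrix of the policy `π`, exponentially weighted by the rewards. -/
noncomputable def expMatrix (M : MDP S A) (β : ℝ) (π : S → A) : Matrix S S ℝ :=
  fun s s' => M.p s (π s) s' * Real.exp (-β * M.r s (π s) s')

/-- Induction peels off the last state, so `f` has to vary. The cases `f = 1` and `f` a unit vector
serve the exponential moments and the state probabilities. -/
theorem sum_path_eq (K : Matrix S S ℝ) (ν : S → ℝ) (t : ℕ) (f : S → ℝ) :
    ∑ x : Fin (t + 1) → S,
      ν (x 0) * (∏ k : Fin t, K (x k.castSucc) (x k.succ)) * f (x (Fin.last t)) =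
      ν ⬝ᵥ (K ^ t *ᵥ f) := by
  induction t generalizing f with
  | zero =>
    rw [← (Equiv.funUnique (Fin 1) S).symm.sum_comp]
    simp [dotProduct]
  | succ t ih =>
    rw [pow_succ, ← mulVec_mulVec, ← ih, ← (Fin.snocEquiv fun _ => S).sum_comp,
      Fintype.sum_prod_type_right]
    refine Finset.sum_congr rfl fun x _ => ?_
    rw [mulVec, dotProduct, Finset.mul_sum]
    refine Finset.sum_congr rfl fun z _ => ?_
    simp only [Fin.snocEquiv, Equiv.coe_fn_mk, Fin.prod_univ_castSucc, Fin.succ_last, Fin.snoc_last,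
      Fin.snoc_castSucc, Fin.succ_castSucc]
    rw [← Fin.castSucc_zero, Fin.snoc_castSucc]
    ring

theorem sum_pathLaw_exp (M : MDP S A) (π : S → A) (ν : S → ℝ) (β : ℝ) (t : ℕ) :
    ∑ x, pathLaw M π ν t x * Real.exp (-β * pathReward M π t x) =
      ν ⬝ᵥ (expMatrix M β π ^ t *ᵥ 1) := by
  rw [← sum_path_eq]
  refine Finset.sum_congr rfl fun x _ => ?_
  simp only [pathLaw, pathReward, expMatrix, Finset.mul_sum, Real.exp_sum, Finset.prod_mul_distrib,
    Pi.one_apply]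
  ring

theorem stateProb_eq (M : MDP S A) (π : S → A) (s : S) (t : ℕ) (s' : S) :
    stateProb M π s t s' = (expMatrix M 0 π ^ t) s s' := by
  have h := sum_path_eq (expMatrix M 0 π) (Pi.single s 1) t (Pi.single s' 1)
  rw [single_one_dotProduct, mulVec_single_one] at h
  simp only [col_apply] at h
  rw [← h, stateProb]
  refine Finset.sum_congr rfl fun x _ => ?_
  simp [pathLaw, expMatrix, Pi.single_apply]

theorem sum_pathLaw (M : MDP S A) (π : S → A) (t : ℕ) : ∑ x, pathLaw M π M.μ t x = 1 := by
  have h := sum_pathLaw_exp M π M.μ 0 t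
  have h1 : ∀ t, expMatrix M 0 π ^ t *ᵥ (1 : S → ℝ) = 1 := by
    intro t
    induction t with
    | zero => simp
    | succ t ih =>
      rw [pow_succ, ← mulVec_mulVec]
      rwa [show expMatrix M 0 π *ᵥ (1 : S → ℝ) = 1 by
        ext s
        simp [expMatrix, mulVec, dotProduct, M.p_sum]]
  rw [h1] at h
  simpa [dotProduct, M.μ_sum] using h

/-- Expected absorption times of a policy. -/
theorem exists_absorptionTime {M : MDP S A} (hM : Transient M) (π : S → A) :
    ∃ m : S → ℝ, (∀ s, 0 ≤ m s) ∧ m M.sink = 0 ∧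
      ∀ s, s ≠ M.sink → m s = 1 + ∑ s', M.p s (π s) s' * m s' := by
  set P := expMatrix M 0 π with hP
  have hPa : ∀ s s', P s s' = M.p s (π s) s' := by simp [hP, expMatrix]
  have hsink : ∀ t s', s' ≠ M.sink → (P ^ t) M.sink s' = 0 := by
    intro t s' hs'
    induction t with
    | zero => simp [hs'.symm]
    | succ t ih =>
      rw [pow_succ', Matrix.mul_apply]
      simp only [hPa]
      rw [sum_p_sink_mul M _ fun s => (P ^ t) s s', ih]
  have hnn : ∀ t s s', 0 ≤ (P ^ t) s s' := by
    intro t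
    induction t with
    | zero => intro s s'; simp only [pow_zero, Matrix.one_apply]; split_ifs <;> norm_num
    | succ t ih =>
      intro s s'
      rw [pow_succ', Matrix.mul_apply]
      exact Finset.sum_nonneg fun i _ => mul_nonneg (by rw [hPa]; exact M.p_nonneg _ _ _) (ih _ _)
  have hsum : ∀ s s', s' ≠ M.sink → Summable fun t => (P ^ t) s s' := by
    intro s s' hs'
    by_cases hs : s = M.sink
    · subst hs
      simp only [hsink _ s' hs']
      exact summable_zero
    · simpa only [stateProb_eq] using hM π s s' hs hs'
  -- The expected number of visits to non-sink states; splitting off the term `t = 0` gives the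
  -- first-step equation.
  refine ⟨fun s => ∑ s' ∈ Finset.univ.erase M.sink, ∑' t, (P ^ t) s s',
    fun s => Finset.sum_nonneg fun s' _ => tsum_nonneg fun t => hnn t s s', ?_, fun s hs => ?_⟩
  · refine Finset.sum_eq_zero fun s' hs' => ?_
    simp [hsink _ s' (Finset.ne_of_mem_erase hs')]
  · have h : ∀ s' ∈ Finset.univ.erase M.sink, ∑' t, (P ^ t) s s' =
        (if s = s' then 1 else 0) + ∑ s'', M.p s (π s) s'' * ∑' t, (P ^ t) s'' s' := by
      intro s' hs'
      have hs' := Finset.ne_of_mem_erase hs'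
      rw [(hsum s s' hs').tsum_eq_zero_add, pow_zero, Matrix.one_apply]
      congr 1
      simp only [← tsum_mul_left]
      rw [← Summable.tsum_finsetSum fun i _ => (hsum i s' hs').mul_left _]
      refine tsum_congr fun t => ?_
      rw [pow_succ', Matrix.mul_apply]
      simp only [hPa]
    beta_reduce
    rw [Finset.sum_congr rfl h, Finset.sum_add_distrib, Finset.sum_comm]
    congr 1
    · simp [hs]
    · simp only [Finset.mul_sum]

end PathSums

/-! ### Reaching the sink, and existence and bounds of the ERM limit. -/

section Absorption

open Matrix

variable {S A : Type*} [Fintype S]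

theorem expMatrix_nonneg (M : MDP S A) (β : ℝ) (π : S → A) (s s' : S) :
    0 ≤ expMatrix M β π s s' :=
  mul_nonneg (M.p_nonneg _ _ _) (Real.exp_pos _).le

theorem expMatrix_mulVec_sink (M : MDP S A) (β : ℝ) (π : S → A) (f : S → ℝ) :
    (expMatrix M β π *ᵥ f) M.sink = f M.sink := by
  simp only [mulVec, dotProduct, expMatrix, mul_assoc]
  rw [sum_p_sink_mul M _ fun s' => Real.exp (-β * M.r M.sink (π M.sink) s') * f s']
  simp [M.r_sink]

theorem mulVec_mono {K : Matrix S S ℝ} (hK : ∀ i j, 0 ≤ K i j) : Monotone (K *ᵥ ·) :=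
  fun _ _ h i => Finset.sum_le_sum fun j _ => mul_le_mul_of_nonneg_left (h j) (hK i j)

theorem dotProduct_mono {ν : S → ℝ} (hν : ∀ s, 0 ≤ ν s) : Monotone (ν ⬝ᵥ ·) :=
  fun _ _ h => Finset.sum_le_sum fun j _ => mul_le_mul_of_nonneg_left (h j) (hν j)

theorem exists_reward_bound (M : MDP S A) (π : S → A) :
    ∃ R : ℝ, 0 ≤ R ∧ ∀ s s', |M.r s (π s) s'| ≤ R := by
  obtain ⟨R, hR⟩ := (Set.finite_range fun x : S × S => |M.r x.1 (π x.1) x.2|).bddAbove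
  exact ⟨R, (abs_nonneg _).trans (hR ⟨(M.sink, M.sink), rfl⟩), fun s s' => hR ⟨(s, s'), rfl⟩⟩

variable [DecidableEq S]

theorem pow_mulVec_mono {K : Matrix S S ℝ} (hK : ∀ i j, 0 ≤ K i j) (t : ℕ) :
    Monotone (K ^ t *ᵥ ·) := by
  induction t with
  | zero => intro f g h; simpa using h
  | succ t ih =>
    intro f g h
    simpa only [pow_succ, ← mulVec_mulVec] using ih (mulVec_mono hK h)

theorem le_pow_mulVec {K : Matrix S S ℝ} (hK : ∀ i j, 0 ≤ K i j) {f : S → ℝ} (h : f ≤ K *ᵥ f) :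
    Monotone fun t : ℕ => K ^ t *ᵥ f := by
  refine monotone_nat_of_le_succ fun t => ?_
  simpa only [pow_succ, ← mulVec_mulVec] using pow_mulVec_mono hK t h

theorem pow_mulVec_le {K : Matrix S S ℝ} (hK : ∀ i j, 0 ≤ K i j) {f : S → ℝ} (h : K *ᵥ f ≤ f) :
    Antitone fun t : ℕ => K ^ t *ᵥ f := by
  refine antitone_nat_of_succ_le fun t => ?_
  simpa only [pow_succ, ← mulVec_mulVec] using pow_mulVec_mono hK t h

theorem expMatrix_pow_mulVec_sink (M : MDP S A) (β : ℝ) (π : S → A) (t : ℕ) (f : S → ℝ) :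
    (expMatrix M β π ^ t *ᵥ f) M.sink = f M.sink := by
  induction t with
  | zero => simp
  | succ t ih => rw [pow_succ', ← mulVec_mulVec, expMatrix_mulVec_sink, ih]

/-- Indicator of the sink. -/
def sinkInd (M : MDP S A) : S → ℝ := Pi.single M.sink 1

theorem sinkInd_nonneg (M : MDP S A) : 0 ≤ sinkInd M := by
  rw [sinkInd, Pi.single_nonneg]; exact zero_le_one

theorem sinkInd_sink (M : MDP S A) : sinkInd M M.sink = 1 := by simp [sinkInd]

theorem sinkInd_of_ne (M : MDP S A) {s : S} (hs : s ≠ M.sink) : sinkInd M s = 0 := by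
  simp [sinkInd, hs]

theorem sinkInd_le {M : MDP S A} {f : S → ℝ} (hf : 0 ≤ f) (h : 1 ≤ f M.sink) :
    sinkInd M ≤ f := by
  intro s
  by_cases hs : s = M.sink
  · rwa [hs, sinkInd_sink]
  · rw [sinkInd_of_ne M hs]; exact hf s

theorem sinkInd_le_one (M : MDP S A) : sinkInd M ≤ 1 := sinkInd_le zero_le_one le_rfl

/-- The sink is absorbing without reward, so weight that has arrived there keeps its value. -/
theorem sinkInd_monotone (M : MDP S A) (β : ℝ) (π : S → A) :
    Monotone fun t : ℕ => expMatrix M β π ^ t *ᵥ sinkInd M := by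
  refine le_pow_mulVec (expMatrix_nonneg M β π) (sinkInd_le ?_ ?_)
  · simpa using mulVec_mono (expMatrix_nonneg M β π) (sinkInd_nonneg M)
  · rw [expMatrix_mulVec_sink, sinkInd_sink]

/-- A set of states that contains all its successors under `π` contains the sink. -/
theorem sink_mem_of_closed {M : MDP S A} (hM : Transient M) (π : S → A) (Z : Set S)
    (hne : Z.Nonempty) (hZ : ∀ s ∈ Z, ∀ s', 0 < M.p s (π s) s' → s' ∈ Z) : M.sink ∈ Z := by
  obtain ⟨m, -, -, hm⟩ := exists_absorptionTime hM π
  -- At a non-sink minimizer of `m` over `Z`, all successors have `m` at least as large,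
  -- contradicting `m s = 1 +` their average.
  obtain ⟨s, hs, hmin⟩ := Set.exists_min_image Z m Z.toFinite hne
  by_contra hsink
  have h1 : m s * ∑ s', M.p s (π s) s' ≤ ∑ s', M.p s (π s) s' * m s' := by
    rw [Finset.mul_sum]
    refine Finset.sum_le_sum fun s' _ => ?_
    rcases (M.p_nonneg s (π s) s').eq_or_lt with h | h
    · simp [← h]
    · rw [mul_comm]
      exact mul_le_mul_of_nonneg_left (hmin s' (hZ s hs s' h)) h.le
  rw [M.p_sum] at h1
  linarith [hm s fun h => hsink (h ▸ hs)]

theorem exists_pow_mulVec_sinkInd_pos {M : MDP S A} (hM : Transient M) (β : ℝ) (π : S → A) :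
    ∃ n : ℕ, ∀ s, 0 < (expMatrix M β π ^ n *ᵥ sinkInd M) s := by
  set K := expMatrix M β π
  have hmono := sinkInd_monotone M β π
  have h0 : ∀ n, 0 ≤ K ^ n *ᵥ sinkInd M := fun n => by
    simpa using pow_mulVec_mono (expMatrix_nonneg M β π) n (sinkInd_nonneg M)
  have h : ∀ s, ∃ n : ℕ, 0 < (K ^ n *ᵥ sinkInd M) s := by
    by_contra! hcon
    have := sink_mem_of_closed hM π {s | ∀ n : ℕ, (K ^ n *ᵥ sinkInd M) s ≤ 0} hcon ?_
    · exact absurd (this 0) (by simp [sinkInd])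
    · intro s hs s' hs' n
      have h1 := hs (n + 1)
      rw [pow_succ', ← mulVec_mulVec] at h1
      have h2 : K s s' * (K ^ n *ᵥ sinkInd M) s' ≤ (K *ᵥ K ^ n *ᵥ sinkInd M) s :=
        Finset.single_le_sum (f := fun s' => K s s' * (K ^ n *ᵥ sinkInd M) s')
          (fun i _ => mul_nonneg (expMatrix_nonneg M β π _ _) (h0 n i)) (Finset.mem_univ s')
      have h3 : 0 < K s s' := mul_pos hs' (Real.exp_pos _)
      exact nonpos_of_mul_nonpos_right (h2.trans h1) h3
  choose n hn using h
  exact ⟨Finset.univ.sup n, fun s =>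
    (hn s).trans_le (hmono (Finset.le_sup (Finset.mem_univ s)) s)⟩

/-- Monotonicity leaves divergence or convergence. In the second case each unit of weight outside
the sink adds at least a fixed `c > 0` to the absorbed weight within `n` steps, so it is controlled
by increments that vanish. -/
theorem weight_dichotomy {M : MDP S A} (hM : Transient M) (β : ℝ) (π : S → A) :
    Tendsto (fun t : ℕ => M.μ ⬝ᵥ (expMatrix M β π ^ t *ᵥ sinkInd M)) atTop atTop ∨
    ∃ W : ℝ, 0 < W ∧
      Tendsto (fun t : ℕ => M.μ ⬝ᵥ (expMatrix M β π ^ t *ᵥ sinkInd M)) atTop (𝓝 W) ∧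
      Tendsto (fun t : ℕ => M.μ ⬝ᵥ (expMatrix M β π ^ t *ᵥ (1 - sinkInd M))) atTop (𝓝 0) := by
  set K := expMatrix M β π with hKdef
  have hK : ∀ i j, 0 ≤ K i j := expMatrix_nonneg M β π
  have hmono : Monotone fun t : ℕ => M.μ ⬝ᵥ (K ^ t *ᵥ sinkInd M) :=
    (dotProduct_mono M.μ_nonneg).comp (sinkInd_monotone M β π)
  refine (tendsto_atTop_of_monotone hmono).imp_right ?_
  rintro ⟨W, hW⟩
  obtain ⟨n, hn⟩ := exists_pow_mulVec_sinkInd_pos hM β π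
  obtain ⟨s₀, -, hs₀⟩ := Finset.exists_min_image Finset.univ (K ^ n *ᵥ sinkInd M)
    ⟨M.sink, Finset.mem_univ _⟩
  set c := (K ^ n *ᵥ sinkInd M) s₀
  have hc : 0 < c := hn s₀
  refine ⟨W, ?_, hW, ?_⟩
  · refine lt_of_lt_of_le ?_ (hmono.ge_of_tendsto hW n)
    calc 0 < c := hc
      _ = M.μ ⬝ᵥ (fun _ => c) := by simp [dotProduct, ← Finset.sum_mul, M.μ_sum]
      _ ≤ _ := dotProduct_mono M.μ_nonneg fun s => hs₀ s (Finset.mem_univ s)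
  · have h1 : c • (1 - sinkInd M) ≤ K ^ n *ᵥ sinkInd M - sinkInd M := by
      intro s
      by_cases hs : s = M.sink
      · simp [hs, sinkInd_sink, hKdef, expMatrix_pow_mulVec_sink]
      · simpa [sinkInd_of_ne M hs] using hs₀ s (Finset.mem_univ s)
    have h2 : ∀ t : ℕ, c * (M.μ ⬝ᵥ (K ^ t *ᵥ (1 - sinkInd M))) ≤
        M.μ ⬝ᵥ (K ^ (t + n) *ᵥ sinkInd M) - M.μ ⬝ᵥ (K ^ t *ᵥ sinkInd M) := by
      intro t
      have := dotProduct_mono M.μ_nonneg (pow_mulVec_mono hK t h1)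
      simpa only [mulVec_smul, dotProduct_smul, mulVec_sub, dotProduct_sub, smul_eq_mul, pow_add,
        mulVec_mulVec] using this
    have h3 : Tendsto (fun t : ℕ => c⁻¹ * (M.μ ⬝ᵥ (K ^ (t + n) *ᵥ sinkInd M) -
        M.μ ⬝ᵥ (K ^ t *ᵥ sinkInd M))) atTop (𝓝 0) := by
      simpa using ((hW.comp (tendsto_add_atTop_nat n)).sub hW).const_mul c⁻¹
    refine squeeze_zero (fun t => ?_) (fun t => ?_) h3
    · have := dotProduct_mono M.μ_nonneg
        (pow_mulVec_mono hK t (sub_nonneg.2 (sinkInd_le_one M)))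
      simpa using this
    · rw [inv_mul_eq_div, le_div_iff₀' hc]
      exact h2 t

theorem erm_path_eq (M : MDP S A) (β : ℝ) (π : S → A) (t : ℕ) :
    erm (pathLaw M π M.μ t) β (pathReward M π t) =
      -β⁻¹ * Real.log (M.μ ⬝ᵥ (expMatrix M β π ^ t *ᵥ 1)) := by
  rw [erm, sum_pathLaw_exp]

theorem weight_eq_add (M : MDP S A) (β : ℝ) (π : S → A) (t : ℕ) :
    M.μ ⬝ᵥ (expMatrix M β π ^ t *ᵥ 1) = M.μ ⬝ᵥ (expMatrix M β π ^ t *ᵥ sinkInd M) +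
      M.μ ⬝ᵥ (expMatrix M β π ^ t *ᵥ (1 - sinkInd M)) := by
  rw [← dotProduct_add, ← mulVec_add, add_sub_cancel]

theorem weight_sinkInd_le (M : MDP S A) (β : ℝ) (π : S → A) (t : ℕ) :
    M.μ ⬝ᵥ (expMatrix M β π ^ t *ᵥ sinkInd M) ≤ M.μ ⬝ᵥ (expMatrix M β π ^ t *ᵥ 1) :=
  dotProduct_mono M.μ_nonneg (pow_mulVec_mono (expMatrix_nonneg M β π) t (sinkInd_le_one M))

theorem tendsto_erm_bot {M : MDP S A} {β : ℝ} (hβ : 0 < β) {π : S → A}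
    (h : Tendsto (fun t : ℕ => M.μ ⬝ᵥ (expMatrix M β π ^ t *ᵥ sinkInd M)) atTop atTop) :
    Tendsto (fun t : ℕ => ((erm (pathLaw M π M.μ t) β (pathReward M π t) : ℝ) : EReal)) atTop
      (𝓝 ⊥) := by
  refine EReal.tendsto_coe_nhds_bot_iff.2 ?_
  simp only [erm_path_eq, neg_mul]
  exact tendsto_neg_atTop_atBot.comp <| (Real.tendsto_log_atTop.comp <|
    tendsto_atTop_mono (weight_sinkInd_le M β π) h).const_mul_atTop (inv_pos.2 hβ)

theorem tendsto_erm_coe {M : MDP S A} {β : ℝ} {π : S → A} {W : ℝ} (hW : 0 < W)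
    (h₁ : Tendsto (fun t : ℕ => M.μ ⬝ᵥ (expMatrix M β π ^ t *ᵥ sinkInd M)) atTop (𝓝 W))
    (h₂ : Tendsto (fun t : ℕ => M.μ ⬝ᵥ (expMatrix M β π ^ t *ᵥ (1 - sinkInd M))) atTop (𝓝 0)) :
    Tendsto (fun t : ℕ => ((erm (pathLaw M π M.μ t) β (pathReward M π t) : ℝ) : EReal)) atTop
      (𝓝 ((-β⁻¹ * Real.log W : ℝ) : EReal)) := by
  refine (continuous_coe_real_ereal.tendsto _).comp ?_
  simp only [erm_path_eq, weight_eq_add]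
  exact ((by simpa using h₁.add h₂ : Tendsto _ _ (𝓝 W)).log hW.ne').const_mul _

theorem tendsto_erm_ermTotal {M : MDP S A} (hM : Transient M) {β : ℝ} (hβ : 0 < β) (π : S → A) :
    Tendsto (fun t : ℕ => ((erm (pathLaw M π M.μ t) β (pathReward M π t) : ℝ) : EReal)) atTop
      (𝓝 (ermTotal M β π)) := by
  rcases weight_dichotomy hM β π with h | ⟨W, hW, h₁, h₂⟩
  · have := tendsto_erm_bot hβ h
    rwa [ermTotal, this.liminf_eq]
  · have := tendsto_erm_coe hW h₁ h₂
    rwa [ermTotal, this.liminf_eq]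

/-- The expected total reward bounds all entropic risk measures. -/
theorem exists_erm_le {M : MDP S A} (hM : Transient M) (π : S → A) :
    ∃ C : ℝ, ∀ β, 0 < β → ∀ t, erm (pathLaw M π M.μ t) β (pathReward M π t) ≤ C := by
  obtain ⟨m, hm0, -, hm⟩ := exists_absorptionTime hM π
  obtain ⟨R, hR0, hR⟩ := exists_reward_bound M π
  obtain ⟨s₀, -, hs₀⟩ := Finset.exists_max_image Finset.univ m ⟨M.sink, Finset.mem_univ _⟩
  refine ⟨R * m s₀, fun β hβ t => ?_⟩
  -- Jensen's inequality turns the first-step equation of `m` into `f ≤ K f`, which bounds the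
  -- exponential moment from below for all `t`.
  set f : S → ℝ := fun s => Real.exp (-(β * R * m s)) with hf
  have hKf : f ≤ expMatrix M β π *ᵥ f := by
    intro s
    by_cases hs : s = M.sink
    · rw [hs, expMatrix_mulVec_sink]
    calc f s = Real.exp (∑ s', M.p s (π s) s' • (-(β * R * (1 + m s')))) := by
          rw [hf]
          beta_reduce
          rw [hm s hs]
          congr 1
          simp only [smul_eq_mul, mul_add, mul_one, mul_neg, Finset.sum_neg_distrib,
            Finset.sum_add_distrib, ← Finset.sum_mul, M.p_sum, one_mul, Finset.mul_sum]
          congr 2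
          exact Finset.sum_congr rfl fun _ _ => by ring
      _ ≤ ∑ s', M.p s (π s) s' • Real.exp (-(β * R * (1 + m s'))) :=
          convexOn_exp.map_sum_le (fun _ _ => M.p_nonneg _ _ _) (M.p_sum _ _)
            fun _ _ => Set.mem_univ _
      _ ≤ (expMatrix M β π *ᵥ f) s := by
          refine Finset.sum_le_sum fun s' _ => ?_
          change _ ≤ M.p s (π s) s' * Real.exp (-β * M.r s (π s) s') * Real.exp _
          rw [mul_assoc (M.p _ _ _), ← Real.exp_add, smul_eq_mul]
          refine mul_le_mul_of_nonneg_left (Real.exp_le_exp.2 ?_) (M.p_nonneg _ _ _)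
          nlinarith [(abs_le.1 (hR s s')).2]
  have h1 : Real.exp (-(β * R * m s₀)) ≤ M.μ ⬝ᵥ (expMatrix M β π ^ t *ᵥ 1) := by
    calc Real.exp (-(β * R * m s₀)) = M.μ ⬝ᵥ (fun _ => Real.exp (-(β * R * m s₀))) := by
          simp [dotProduct, ← Finset.sum_mul, M.μ_sum]
      _ ≤ M.μ ⬝ᵥ f := dotProduct_mono M.μ_nonneg fun s => Real.exp_le_exp.2 <|
          neg_le_neg <| mul_le_mul_of_nonneg_left (hs₀ s (Finset.mem_univ s)) (by positivity)
      _ ≤ M.μ ⬝ᵥ (expMatrix M β π ^ t *ᵥ f) := dotProduct_mono M.μ_nonneg <| by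
          simpa using le_pow_mulVec (expMatrix_nonneg M β π) hKf (Nat.zero_le t)
      _ ≤ _ := dotProduct_mono M.μ_nonneg <| pow_mulVec_mono (expMatrix_nonneg M β π) t fun s =>
          Real.exp_le_one_iff.2 <| neg_nonpos.2 <| mul_nonneg (by positivity) (hm0 s)
  have h2 := Real.log_le_log (Real.exp_pos _) h1
  rw [Real.log_exp] at h2
  rw [erm_path_eq, neg_mul, neg_le, inv_mul_eq_div, le_div_iff₀ hβ]
  linarith

/-- For small risk levels the entropic risk measure of the total reward is finite. -/
theorem exists_ermTotal_ne_bot {M : MDP S A} (hM : Transient M) (π : S → A) :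
    ∃ β₁ : ℝ, 0 < β₁ ∧ ∀ β, 0 < β → β ≤ β₁ → ermTotal M β π ≠ ⊥ := by
  obtain ⟨m, hm0, -, hm⟩ := exists_absorptionTime hM π
  obtain ⟨R, hR0, hR⟩ := exists_reward_bound M π
  obtain ⟨s₀, -, hs₀⟩ := Finset.exists_max_image Finset.univ m ⟨M.sink, Finset.mem_univ _⟩
  have hm1 := hm0 s₀
  -- This threshold gives `f ≤ 2` and `β R ≤ 1` below. Then `exp(β R) ≤ 1 + 2 β R`, and the growth
  -- `2 β R f ≤ 4 β R` is absorbed by the drop `β (4 R + 1)` of `f`, so `K f ≤ f`.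
  refine ⟨((4 * R + 1) * (m s₀ + 1))⁻¹, by positivity, fun β hβ hβ₁ => ?_⟩
  have hβm : β * ((4 * R + 1) * (m s₀ + 1)) ≤ 1 := by
    rwa [← le_div_iff₀ (by positivity), one_div]
  have hβR : β * R ≤ 1 := by nlinarith [mul_nonneg hβ.le hR0, mul_nonneg (mul_nonneg hβ.le hR0) hm1]
  set f : S → ℝ := fun s => 1 + β * (4 * R + 1) * m s with hf
  have hf1 : ∀ s, 1 ≤ f s := fun s => by
    have := hm0 s
    simp only [hf, le_add_iff_nonneg_right]; positivity
  have hf2 : ∀ s, f s ≤ 2 := fun s => by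
    have h := mul_le_mul_of_nonneg_left (hs₀ s (Finset.mem_univ s))
      (by positivity : 0 ≤ β * (4 * R + 1))
    have : 0 < β * (4 * R + 1) := by positivity
    simp only [hf]
    linarith
  have hexp : Real.exp (β * R) ≤ 1 + 2 * (β * R) := by
    have := Real.abs_exp_sub_one_le (x := β * R) (by rwa [abs_of_nonneg (by positivity)])
    rw [abs_of_nonneg (by positivity : 0 ≤ β * R)] at this
    linarith [le_abs_self (Real.exp (β * R) - 1)]
  have hKf : expMatrix M β π *ᵥ f ≤ f := by
    intro s
    by_cases hs : s = M.sink
    · rw [hs, expMatrix_mulVec_sink]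
    have hsum : ∑ s', M.p s (π s) s' * f s' = f s - β * (4 * R + 1) := by
      simp only [hf, mul_add, mul_one, Finset.sum_add_distrib, M.p_sum, hm s hs, Finset.mul_sum]
      rw [add_sub_assoc]
      congr 1
      rw [add_sub_cancel_left]
      exact Finset.sum_congr rfl fun _ _ => by ring
    calc (expMatrix M β π *ᵥ f) s
        ≤ ∑ s', Real.exp (β * R) * (M.p s (π s) s' * f s') := by
          refine Finset.sum_le_sum fun s' _ => ?_
          have h1 : Real.exp (-β * M.r s (π s) s') ≤ Real.exp (β * R) :=
            Real.exp_le_exp.2 (by nlinarith [(abs_le.1 (hR s s')).1])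
          have h2 : 0 ≤ M.p s (π s) s' * f s' :=
            mul_nonneg (M.p_nonneg _ _ _) (zero_le_one.trans (hf1 s'))
          calc expMatrix M β π s s' * f s'
              = Real.exp (-β * M.r s (π s) s') * (M.p s (π s) s' * f s') := by
                rw [expMatrix]; ring
            _ ≤ _ := mul_le_mul_of_nonneg_right h1 h2
      _ = Real.exp (β * R) * (f s - β * (4 * R + 1)) := by rw [← Finset.mul_sum, hsum]
      _ ≤ (1 + 2 * (β * R)) * (f s - β * (4 * R + 1)) := by
          refine mul_le_mul_of_nonneg_right hexp ?_
          rw [← hsum]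
          exact Finset.sum_nonneg fun s' _ =>
            mul_nonneg (M.p_nonneg _ _ _) (zero_le_one.trans (hf1 s'))
      _ ≤ f s := by
          have h3 : β * R * f s ≤ β * R * 2 := mul_le_mul_of_nonneg_left (hf2 s) (by positivity)
          have h4 : 0 ≤ β * R * (β * (4 * R + 1)) := by positivity
          nlinarith
  have hbd : ∀ t : ℕ, M.μ ⬝ᵥ (expMatrix M β π ^ t *ᵥ sinkInd M) ≤ 2 := by
    intro t
    calc M.μ ⬝ᵥ (expMatrix M β π ^ t *ᵥ sinkInd M)
        ≤ M.μ ⬝ᵥ (expMatrix M β π ^ t *ᵥ f) := dotProduct_mono M.μ_nonneg <|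
          pow_mulVec_mono (expMatrix_nonneg M β π) t <|
          sinkInd_le (fun s => zero_le_one.trans (hf1 s)) (hf1 _)
      _ ≤ M.μ ⬝ᵥ f := dotProduct_mono M.μ_nonneg <| by
          simpa using pow_mulVec_le (expMatrix_nonneg M β π) hKf (Nat.zero_le t)
      _ ≤ M.μ ⬝ᵥ (fun _ => 2) := dotProduct_mono M.μ_nonneg hf2
      _ = 2 := by simp [dotProduct, ← Finset.sum_mul, M.μ_sum]
  rcases weight_dichotomy hM β π with h | ⟨W, hW, h₁, h₂⟩
  · obtain ⟨t, ht⟩ := (h.eventually_gt_atTop 2).exists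
    exact absurd (hbd t) ht.not_ge
  · rw [ermTotal, (tendsto_erm_coe hW h₁ h₂).liminf_eq]
    exact EReal.coe_ne_bot _

end Absorption

/-- The power mean inequality with exponent `β' / β ≥ 1`, applied to `exp(-β f)`. -/
theorem erm_anti {X : Type*} [Fintype X] {w : X → ℝ} (hw : ∀ x, 0 ≤ w x) (hw1 : ∑ x, w x = 1)
    {β β' : ℝ} (hβ : 0 < β) (hββ' : β ≤ β') (f : X → ℝ) : erm w β' f ≤ erm w β f := by
  have hβ' : 0 < β' := hβ.trans_le hββ'
  have hpos : 0 < ∑ x, w x * Real.exp (-β * f x) := by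
    obtain ⟨x, -, hx⟩ : ∃ x ∈ Finset.univ, 0 < w x :=
      Finset.exists_lt_of_sum_lt (f := fun _ => (0 : ℝ)) (by simp [hw1])
    exact Finset.sum_pos' (fun x _ => mul_nonneg (hw x) (Real.exp_pos _).le)
      ⟨x, Finset.mem_univ x, mul_pos hx (Real.exp_pos _)⟩
  have h := Real.rpow_arith_mean_le_arith_mean_rpow Finset.univ w (fun x => Real.exp (-β * f x))
    (fun x _ => hw x) hw1 (fun x _ => (Real.exp_pos _).le) ((one_le_div hβ).2 hββ')
  have h1 : ∀ x, Real.exp (-β * f x) ^ (β' / β) = Real.exp (-β' * f x) := by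
    intro x
    rw [← Real.exp_mul]
    congr 1
    field_simp
  simp only [h1] at h
  have h2 := Real.log_le_log (Real.rpow_pos_of_pos hpos _) h
  rw [Real.log_rpow hpos] at h2
  rw [erm, erm, neg_mul, neg_mul, neg_le_neg_iff]
  calc _ = β'⁻¹ * (β' / β * Real.log (∑ x, w x * Real.exp (-β * f x))) := by field_simp
    _ ≤ _ := mul_le_mul_of_nonneg_left h2 (inv_pos.2 hβ').le

/-! ### The grid of risk levels. -/

section Grid

variable {α δ β₀ : ℝ}

theorem log_one_div_pos (hα₀ : 0 < α) (hα₁ : α < 1) : 0 < Real.log (1 / α) :=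
  Real.log_pos (by rwa [lt_div_iff₀ hα₀, one_mul])

/-- The recursion is an arithmetic progression in `1/β`. It is valid as long as the earlier points
lie below `log (1/α) / δ`, which keeps the denominators positive. -/
theorem gridPt_inv (hα₀ : 0 < α) (hα₁ : α < 1) (hδ : 0 < δ) (hβ₀ : 0 < β₀) (k : ℕ)
    (hk : ∀ j < k, gridPt α δ β₀ j < Real.log (1 / α) / δ) :
    0 < gridPt α δ β₀ k ∧ (gridPt α δ β₀ k)⁻¹ = β₀⁻¹ - k * (δ / Real.log (1 / α)) := by
  induction k with
  | zero => simpa [gridPt] using hβ₀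
  | succ k ih =>
    obtain ⟨h1, h2⟩ := ih fun j hj => hk j (hj.trans k.lt_succ_self)
    have hL := log_one_div_pos hα₀ hα₁
    have h3 := hk k k.lt_succ_self
    rw [lt_div_iff₀ hδ] at h3
    have h4 : 0 < Real.log (1 / α) - gridPt α δ β₀ k * δ := by linarith
    rw [gridPt]
    refine ⟨by positivity, ?_⟩
    push_cast
    rw [add_mul, ← sub_sub, ← h2]
    field_simp

theorem gridLast_spec (hα₀ : 0 < α) (hα₁ : α < 1) (hδ : 0 < δ) (hβ₀ : 0 < β₀) :
    Real.log (1 / α) / δ ≤ gridPt α δ β₀ (gridLast α δ β₀) := by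
  have hL := log_one_div_pos hα₀ hα₁
  refine Nat.sInf_mem (s := {k : ℕ | Real.log (1 / α) / δ ≤ gridPt α δ β₀ k}) ?_
  by_contra hne
  have h : ∀ k, gridPt α δ β₀ k < Real.log (1 / α) / δ := fun k =>
    not_le.1 fun hk => hne ⟨k, hk⟩
  obtain ⟨n, hn⟩ := exists_nat_gt (β₀⁻¹ / (δ / Real.log (1 / α)))
  rw [div_lt_iff₀ (by positivity)] at hn
  obtain ⟨h1, h2⟩ := gridPt_inv hα₀ hα₁ hδ hβ₀ n fun j _ => h j
  have := inv_pos.2 h1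
  linarith

theorem lt_of_lt_gridLast {k : ℕ} (hk : k < gridLast α δ β₀) :
    gridPt α δ β₀ k < Real.log (1 / α) / δ :=
  not_le.1 (Nat.notMem_of_lt_sInf (s := {k : ℕ | Real.log (1 / α) / δ ≤ gridPt α δ β₀ k}) hk)

theorem gridPt_pos (hα₀ : 0 < α) (hα₁ : α < 1) (hδ : 0 < δ) (hβ₀ : 0 < β₀) {k : ℕ}
    (hk : k ≤ gridLast α δ β₀) : 0 < gridPt α δ β₀ k :=
  (gridPt_inv hα₀ hα₁ hδ hβ₀ k fun _ hj => lt_of_lt_gridLast (hj.trans_le hk)).1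

theorem pos_of_mem_grid (hα₀ : 0 < α) (hα₁ : α < 1) (hδ : 0 < δ) (hβ₀ : 0 < β₀) {b : ℝ}
    (hb : b ∈ grid α δ β₀) : 0 < b := by
  obtain ⟨k, hk, rfl⟩ := Finset.mem_image.1 hb
  exact gridPt_pos hα₀ hα₁ hδ hβ₀ (Nat.lt_succ_iff.1 (Finset.mem_range.1 hk))

/-- Otherwise every grid point, the last included, would be at most `β` and violate the bound; but
the last one has `1/β_K ≤ δ / log (1/α)`, so it satisfies the bound trivially. -/
theorem exists_grid_near (hα₀ : 0 < α) (hα₁ : α < 1) (hδ : 0 < δ) (hβ₀ : 0 < β₀) {β : ℝ}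
    (hβ : β₀ ≤ β) : ∃ b ∈ grid α δ β₀, b ≤ β ∧ b⁻¹ - δ / Real.log (1 / α) ≤ β⁻¹ := by
  have hL := log_one_div_pos hα₀ hα₁
  by_contra! hcon
  have hcon' : ∀ k ≤ gridLast α δ β₀, gridPt α δ β₀ k ≤ β →
      β⁻¹ < (gridPt α δ β₀ k)⁻¹ - δ / Real.log (1 / α) := fun k hk =>
    hcon _ (Finset.mem_image_of_mem _ (Finset.mem_range.2 (Nat.lt_succ_of_le hk)))
  have h : ∀ k ≤ gridLast α δ β₀, gridPt α δ β₀ k ≤ β := by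
    intro k
    induction k with
    | zero => intro _; simpa [gridPt] using hβ
    | succ k ih =>
      intro hk
      have h1 := hcon' k (by omega) (ih (by omega))
      have h2 := (gridPt_inv hα₀ hα₁ hδ hβ₀ k fun j hj => lt_of_lt_gridLast (by omega)).2
      obtain ⟨h4, h3⟩ := gridPt_inv hα₀ hα₁ hδ hβ₀ (k + 1) fun j hj => lt_of_lt_gridLast (by omega)
      push_cast at h3
      refine (inv_le_inv₀ (hβ₀.trans_le hβ) h4).1 ?_
      linarith
  have h1 := hcon' _ le_rfl (h _ le_rfl)
  have h2 : (gridPt α δ β₀ (gridLast α δ β₀))⁻¹ ≤ δ / Real.log (1 / α) := by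
    rw [← inv_div]
    exact inv_anti₀ (by positivity) (gridLast_spec hα₀ hα₁ hδ hβ₀)
  have := inv_pos.2 (hβ₀.trans_le hβ)
  linarith

/-- Here `e` stands for the ERM of a fixed return. Neither alternative depends on more than
antitonicity and the bound `C`, which is why the cover is uniform in the horizon. -/
theorem grid_cover (hα₀ : 0 < α) (hα₁ : α < 1) (hδ : 0 < δ) (hβ₀ : 0 < β₀) {e : ℝ → ℝ} {C : ℝ}
    (he : ∀ β β', 0 < β → β ≤ β' → e β' ≤ e β) (hC : ∀ β, 0 < β → e β ≤ C) {β : ℝ} (hβ : 0 < β) :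
    e β + β⁻¹ * Real.log α ≤ C + β₀⁻¹ * Real.log α ∨
      ∃ b ∈ grid α δ β₀, e β + β⁻¹ * Real.log α ≤ e b + b⁻¹ * Real.log α + δ := by
  have hL := log_one_div_pos hα₀ hα₁
  have hlog : Real.log α = -Real.log (1 / α) := by simp
  rw [hlog]
  rcases lt_or_ge β β₀ with h | h
  · left
    have := mul_le_mul_of_nonneg_right (inv_anti₀ hβ h.le) hL.le
    linarith [hC β hβ]
  · right
    obtain ⟨b, hb, hbβ, hb'⟩ := exists_grid_near hα₀ hα₁ hδ hβ₀ h
    refine ⟨b, hb, ?_⟩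
    have h1 := mul_le_mul_of_nonneg_right hb' hL.le
    rw [sub_mul, div_mul_cancel₀ _ hL.ne'] at h1
    linarith [he b β (pos_of_mem_grid hα₀ hα₁ hδ hβ₀ hb) hbβ]

end Grid

/-! ### EVaR of the total reward and optimality of the grid maximizer. -/

section Evar

variable {S A : Type*} [Fintype S] [DecidableEq S] {M : MDP S A} {α δ β₀ : ℝ}

theorem tendsto_hVal (hM : Transient M) (α : ℝ) {β : ℝ} (hβ : 0 < β) (π : S → A) :
    Tendsto (fun t : ℕ => ((erm (pathLaw M π M.μ t) β (pathReward M π t) +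
      β⁻¹ * Real.log α : ℝ) : EReal)) atTop (𝓝 (hVal M α π β)) := by
  simp only [EReal.coe_add]
  exact (EReal.continuousAt_add (Or.inr (EReal.coe_ne_bot _)) (Or.inr (EReal.coe_ne_top _))).tendsto.comp
    ((tendsto_erm_ermTotal hM hβ π).prodMk_nhds tendsto_const_nhds)

/-- The grid is finite, so a strict failure in the limit would already occur at some finite horizon,
where `grid_cover` excludes it. -/
theorem hVal_cover (hM : Transient M) (hα₀ : 0 < α) (hα₁ : α < 1) (hδ : 0 < δ) (hβ₀ : 0 < β₀)
    {π : S → A} {C : ℝ}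
    (hC : ∀ β, 0 < β → ∀ t, erm (pathLaw M π M.μ t) β (pathReward M π t) ≤ C)
    {β : ℝ} (hβ : 0 < β) : hVal M α π β ≤ ((C + β₀⁻¹ * Real.log α : ℝ) : EReal) ∨
      ∃ b ∈ grid α δ β₀, hVal M α π β ≤ hVal M α π b + (δ : EReal) := by
  by_contra! hcon
  obtain ⟨h1, h2⟩ := hcon
  have hlim := tendsto_hVal hM α hβ π
  have h3 : ∀ᶠ t : ℕ in atTop, ∀ b ∈ grid α δ β₀,
      ((erm (pathLaw M π M.μ t) b (pathReward M π t) + b⁻¹ * Real.log α : ℝ) : EReal) + (δ : EReal) <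
      ((erm (pathLaw M π M.μ t) β (pathReward M π t) + β⁻¹ * Real.log α : ℝ) : EReal) := by
    rw [Filter.eventually_all_finset]
    intro b hb
    refine Tendsto.eventually_lt ?_ hlim (h2 b hb)
    exact (EReal.continuousAt_add (Or.inr (EReal.coe_ne_bot _))
      (Or.inr (EReal.coe_ne_top _))).tendsto.comp
      ((tendsto_hVal hM α (pos_of_mem_grid hα₀ hα₁ hδ hβ₀ hb) π).prodMk_nhds tendsto_const_nhds)
  obtain ⟨t, h4, h5⟩ := ((hlim.eventually_const_lt h1).and h3).exists
  rcases grid_cover hα₀ hα₁ hδ hβ₀ (fun β β' hβ hββ' => erm_anti (pathLaw_nonneg M π t)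
    (sum_pathLaw M π t) hβ hββ' (pathReward M π t)) (fun β hβ => hC β hβ t) hβ with h | ⟨b, hb, h⟩
  · exact absurd (EReal.coe_le_coe_iff.2 h) h4.not_ge
  · have := h5 b hb
    rw [← EReal.coe_add, EReal.coe_lt_coe_iff] at this
    linarith

theorem exists_lt_of_inv_mul_log (hα₀ : 0 < α) (hα₁ : α < 1) (C y : ℝ) :
    ∃ β₁ > 0, ∀ β, 0 < β → β ≤ β₁ → C + β⁻¹ * Real.log α < y := by
  have hlog := Real.log_neg hα₀ hα₁
  have h : Tendsto (fun β : ℝ => C + β⁻¹ * Real.log α) (𝓝[>] 0) atBot :=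
    tendsto_atBot_add_const_left _ _ (tendsto_inv_nhdsGT_zero.atTop_mul_const_of_neg hlog)
  obtain ⟨β₁, hβ₁, h1⟩ := mem_nhdsGT_iff_exists_Ioc_subset.1 (h.eventually_lt_atBot y)
  exact ⟨β₁, hβ₁, fun β h0 hβ => h1 ⟨h0, hβ⟩⟩

/-- The EVaR of the truncated return converges to the supremum of `h(π, ·)`. -/
theorem exists_tendsto_evarReturn (hM : Transient M) (hα₀ : 0 < α) (hα₁ : α < 1) (π : S → A) :
    ∃ V : ℝ, Tendsto (evarReturn M α π) atTop (𝓝 (V : EReal)) ∧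
      IsLUB {y | ∃ β, 0 < β ∧ y = hVal M α π β} (V : EReal) := by
  obtain ⟨C, hC⟩ := exists_erm_le hM π
  have hlog := Real.log_neg hα₀ hα₁
  set X : Set EReal := {y | ∃ β, 0 < β ∧ y = hVal M α π β} with hX
  have hmem : ∀ β, 0 < β → hVal M α π β ∈ X := fun β hβ => ⟨β, hβ, rfl⟩
  have hle : ∀ β, 0 < β → hVal M α π β ≤ sSup X := fun β hβ => le_sSup (hmem β hβ)
  have htop : sSup X ≤ (C : EReal) := by
    refine sSup_le ?_
    rintro y ⟨β, hβ, rfl⟩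
    refine le_of_tendsto' (tendsto_hVal hM α hβ π) fun t => EReal.coe_le_coe_iff.2 ?_
    have := mul_neg_of_pos_of_neg (inv_pos.2 hβ) hlog
    linarith [hC β hβ t]
  have hbot : sSup X ≠ ⊥ := by
    obtain ⟨β₁, hβ₁, h⟩ := exists_ermTotal_ne_bot hM π
    refine ne_bot_of_le_ne_bot ?_ (hle β₁ hβ₁)
    rw [hVal, Ne, EReal.add_eq_bot_iff, not_or]
    exact ⟨h β₁ hβ₁ le_rfl, EReal.coe_ne_bot _⟩
  have hV := EReal.coe_toReal (htop.trans_lt (EReal.coe_lt_top C)).ne hbot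
  set V := (sSup X).toReal
  refine ⟨V, ?_, hV ▸ isLUB_sSup X⟩
  rw [tendsto_order]
  constructor
  · intro y hy
    rw [hV] at hy
    obtain ⟨_, ⟨β, hβ, rfl⟩, h⟩ := lt_sSup_iff.1 hy
    filter_upwards [(tendsto_hVal hM α hβ π).eventually_const_lt h] with t ht
    exact ht.trans_le (le_iSup₂ (f := fun (β : ℝ) (_ : 0 < β) =>
      ((erm (pathLaw M π M.μ t) β (pathReward M π t) + β⁻¹ * Real.log α : ℝ) : EReal)) β hβ)
  · intro y hy
    obtain ⟨z, hz, hzy⟩ := EReal.lt_iff_exists_real_btwn.1 hy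
    rw [EReal.coe_lt_coe_iff] at hz
    obtain ⟨β₁, hβ₁, h1⟩ := exists_lt_of_inv_mul_log hα₀ hα₁ C z
    -- With mesh `(z - V) / 2`, finitely many levels eventually below the midpoint `(z + V) / 2`
    -- keep all levels at or below `z`.
    have hδ : 0 < (z - V) / 2 := by linarith
    have h2 : ∀ᶠ t : ℕ in atTop, ∀ b ∈ grid α ((z - V) / 2) β₁,
        ((erm (pathLaw M π M.μ t) b (pathReward M π t) + b⁻¹ * Real.log α : ℝ) : EReal) <
          (((z + V) / 2 : ℝ) : EReal) := by
      rw [Filter.eventually_all_finset]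
      intro b hb
      have hb := pos_of_mem_grid hα₀ hα₁ hδ hβ₁ hb
      refine (tendsto_hVal hM α hb π).eventually_lt_const ((hle b hb).trans_lt ?_)
      rw [← hV, EReal.coe_lt_coe_iff]
      linarith
    filter_upwards [h2] with t ht
    refine lt_of_le_of_lt (iSup₂_le fun β hβ => EReal.coe_le_coe_iff.2 ?_) hzy
    rcases grid_cover hα₀ hα₁ hδ hβ₁ (fun β β' hβ hββ' => erm_anti (pathLaw_nonneg M π t)
      (sum_pathLaw M π t) hβ hββ' (pathReward M π t)) (fun β hβ => hC β hβ t) hβ with h | ⟨b, hb, h⟩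
    · linarith [h1 β₁ hβ₁ le_rfl]
    · have := EReal.coe_lt_coe_iff.1 (ht b hb)
      linarith

/-- For fine grids, a policy that attains the maximal value of `h⋆` over the grid is
`δ`-optimal, and this maximal value is finite. -/
theorem exists_grid_deltaOptimal [Finite A] (hM : Transient M) (hα₀ : 0 < α) (hα₁ : α < 1)
    (hδ : 0 < δ) :
    ∃ βbar : ℝ, 0 < βbar ∧ ∀ β₀, 0 < β₀ → β₀ ≤ βbar →
      ∀ β ∈ grid α δ β₀, (∀ β' ∈ grid α δ β₀, hStar M α β' ≤ hStar M α β) →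
        (Nonempty (S → A) → hStar M α β ≠ ⊥) ∧
        ∀ π : S → A, hVal M α π β = hStar M α β → DeltaOptimal M α δ π := by
  choose C hC using fun π : S → A => exists_erm_le hM π
  choose b hb hbot using fun π : S → A => exists_ermTotal_ne_bot hM π
  have hne : ∀ π, hVal M α π (b π) ≠ ⊥ := fun π => by
    rw [hVal, Ne, EReal.add_eq_bot_iff, not_or]
    exact ⟨hbot π _ (hb π) le_rfl, EReal.coe_ne_bot _⟩
  choose y _ hy using fun π : S → A => EReal.lt_iff_exists_real_btwn.1 (bot_lt_iff_ne_bot.2 (hne π))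
  -- For `β₀ ≤ β₁ π` the bound on levels below `β₀` lies under `h(π, b π)`, a value that the grid
  -- does cover.
  choose β₁ hβ₁ h1 using fun π : S → A => exists_lt_of_inv_mul_log hα₀ hα₁ (C π) (y π)
  choose V hV hlub using fun π : S → A => exists_tendsto_evarReturn hM hα₀ hα₁ π
  have : ∃ βbar : ℝ, 0 < βbar ∧ ∀ π, βbar ≤ β₁ π := by
    rcases isEmpty_or_nonempty (S → A) with hE | hE
    · exact ⟨1, one_pos, fun π => hE.elim π⟩
    · obtain ⟨π, hπ⟩ := Finite.exists_min β₁
      exact ⟨β₁ π, hβ₁ π, hπ⟩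
  obtain ⟨βbar, hpos, hbar⟩ := this
  refine ⟨βbar, hpos, fun β₀ hβ₀ hle β hβ hmax => ?_⟩
  have key : ∀ π β', 0 < β' → hVal M α π β' ≤ hStar M α β + (δ : EReal) := by
    intro π
    have hgrid : ∀ b ∈ grid α δ β₀, hVal M α π b + (δ : EReal) ≤ hStar M α β + (δ : EReal) :=
      fun b hb => add_le_add_left ((le_iSup (fun π => hVal M α π b) π).trans (hmax b hb)) _
    have hlt : ((C π + β₀⁻¹ * Real.log α : ℝ) : EReal) < hVal M α π (b π) :=
      (EReal.coe_lt_coe_iff.2 (h1 π β₀ hβ₀ (hle.trans (hbar π)))).trans (hy π)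
    have h2 : hVal M α π (b π) ≤ hStar M α β + (δ : EReal) := by
      rcases hVal_cover hM hα₀ hα₁ hδ hβ₀ (hC π) (hb π) with h | ⟨b', hb', h⟩
      · exact absurd h hlt.not_ge
      · exact h.trans (hgrid b' hb')
    intro β' hβ'
    rcases hVal_cover hM hα₀ hα₁ hδ hβ₀ (hC π) hβ' with h | ⟨b', hb', h⟩
    · exact h.trans (hlt.le.trans h2)
    · exact h.trans (hgrid b' hb')
  refine ⟨fun ⟨π⟩ hbot => ?_, fun π hπ => ⟨V, hV, fun π' => ?_⟩⟩
  · have := key π (b π) (hb π)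
    rw [hbot, EReal.bot_add, le_bot_iff] at this
    exact hne π this
  · have h2 : (V π' : EReal) ≤ hStar M α β + (δ : EReal) := (hlub π').2 <| by
      rintro _ ⟨β', hβ', rfl⟩
      exact key π' β' hβ'
    have h3 : hStar M α β ≤ (V π : EReal) :=
      hπ ▸ (hlub π).1 ⟨β, pos_of_mem_grid hα₀ hα₁ hδ hβ₀ hβ, rfl⟩
    have h4 := h2.trans (add_le_add_left h3 _)
    rw [← EReal.coe_add, EReal.coe_le_coe_iff] at h4
    linarith

end Evar

/-! ### The exponential Bellman equation: comparison and identification of `h⋆`. -/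

section ExponentialBellman

open Matrix

section MaxQ

variable {S A : Type*} [Fintype A] [Nonempty A]

theorem le_maxQ (q : S → A → ℝ) (s : S) (a : A) : q s a ≤ maxQ q s :=
  Finset.le_sup' (q s) (Finset.mem_univ a)

theorem exists_eq_maxQ (q : S → A → ℝ) (s : S) : ∃ a, maxQ q s = q s a := by
  obtain ⟨a, -, h⟩ := Finset.exists_mem_eq_sup' Finset.univ_nonempty (q s)
  exact ⟨a, h⟩

theorem maxQ_le_iff {q : S → A → ℝ} {s : S} {c : ℝ} : maxQ q s ≤ c ↔ ∀ a, q s a ≤ c := by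
  simp [maxQ, Finset.sup'_le_iff]

theorem maxQ_eq_of_greedy {q : S → A → ℝ} {π : S → A} (h : Greedy (some q) π) (s : S) :
    maxQ q s = q s (π s) :=
  le_antisymm (maxQ_le_iff.2 (h s)) (le_maxQ _ _ _)

end MaxQ

section Bellman

variable {S A : Type*} [Fintype S]

/-- A supersolution of the linear equation of a policy dominates every subsolution. -/
theorem le_of_mulVec_le [DecidableEq S] {M : MDP S A} (hM : Transient M) {β : ℝ} {π : S → A}
    {f g : S → ℝ} (hf0 : ∀ s, 0 < f s) (hf : expMatrix M β π *ᵥ f ≤ f)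
    (hg : g ≤ expMatrix M β π *ᵥ g) (hfg : g M.sink ≤ f M.sink) : g ≤ f := by
  obtain ⟨s₀, -, hs₀⟩ := Finset.exists_max_image Finset.univ (fun s => g s / f s)
    ⟨M.sink, Finset.mem_univ _⟩
  -- If the maximal ratio `c` exceeds 1, equality `g = c f` passes to all successors, hence to the
  -- sink, against `g ≤ f` there.
  set c := g s₀ / f s₀ with hc
  have hgc : ∀ s, g s ≤ c * f s := fun s => (div_le_iff₀ (hf0 s)).1 (hs₀ s (Finset.mem_univ s))
  suffices hc1 : c ≤ 1 from fun s => (hgc s).trans (mul_le_of_le_one_left (hf0 s).le hc1)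
  by_contra! hc1
  have := sink_mem_of_closed hM π {s | g s = c * f s} ⟨s₀, (div_mul_cancel₀ _ (hf0 s₀).ne').symm⟩ ?_
  · have h : g M.sink = c * f M.sink := this
    nlinarith [hf0 M.sink]
  · intro s hs s' hs'
    have h1 : ∑ s', expMatrix M β π s s' * (c * f s' - g s') ≤ 0 := by
      have h2 : ∑ s', expMatrix M β π s s' * (c * f s' - g s') =
          c * (expMatrix M β π *ᵥ f) s - (expMatrix M β π *ᵥ g) s := by
        simp only [mulVec, dotProduct, Finset.mul_sum, ← Finset.sum_sub_distrib]
        exact Finset.sum_congr rfl fun _ _ => by ring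
      have h3 : c * (expMatrix M β π *ᵥ f) s ≤ c * f s :=
        mul_le_mul_of_nonneg_left (hf s) (by linarith)
      have h4 : g s = c * f s := hs
      linarith [hg s]
    have h2 : ∀ s' ∈ Finset.univ, 0 ≤ expMatrix M β π s s' * (c * f s' - g s') := fun s' _ =>
      mul_nonneg (expMatrix_nonneg M β π s s') (sub_nonneg.2 (hgc s'))
    have h3 := (Finset.sum_eq_zero_iff_of_nonneg h2).1 (le_antisymm h1 (Finset.sum_nonneg h2)) s'
      (Finset.mem_univ s')
    have h4 : 0 < expMatrix M β π s s' := mul_pos hs' (Real.exp_pos _)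
    have h5 := (mul_eq_zero.1 h3).resolve_left h4.ne'
    change g s' = c * f s'
    linarith

/-- Iterating gives `w ≤ K^t w`, and `w` is 1 at the sink and bounded elsewhere; once the outside
weight vanishes, `μ · w` is at most the absorbed weight. -/
theorem ermTotal_le_of_le_mulVec [DecidableEq S] {M : MDP S A} (hM : Transient M) {β : ℝ}
    (hβ : 0 < β) {π : S → A} {w : S → ℝ} (hw0 : ∀ s, 0 < w s) (hsink : w M.sink = 1)
    (hw : w ≤ expMatrix M β π *ᵥ w) :
    ermTotal M β π ≤ ((-β⁻¹ * Real.log (M.μ ⬝ᵥ w) : ℝ) : EReal) := by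
  rcases weight_dichotomy hM β π with h | ⟨W, hW, h₁, h₂⟩
  · rw [ermTotal, (tendsto_erm_bot hβ h).liminf_eq]
    exact bot_le
  · rw [ermTotal, (tendsto_erm_coe hW h₁ h₂).liminf_eq, EReal.coe_le_coe_iff, neg_mul, neg_mul,
      neg_le_neg_iff]
    refine mul_le_mul_of_nonneg_left ?_ (inv_pos.2 hβ).le
    obtain ⟨s₀, -, hs₀⟩ := Finset.exists_max_image Finset.univ w ⟨M.sink, Finset.mem_univ _⟩
    obtain ⟨s₁, -, hs₁⟩ := Finset.exists_min_image Finset.univ w ⟨M.sink, Finset.mem_univ _⟩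
    have hpos : 0 < M.μ ⬝ᵥ w := by
      calc 0 < w s₁ := hw0 s₁
        _ = M.μ ⬝ᵥ (fun _ => w s₁) := by simp [dotProduct, ← Finset.sum_mul, M.μ_sum]
        _ ≤ _ := dotProduct_mono M.μ_nonneg fun s => hs₁ s (Finset.mem_univ s)
    refine Real.log_le_log hpos ?_
    have hlim := h₁.add (h₂.const_mul (w s₀))
    rw [mul_zero, add_zero] at hlim
    refine ge_of_tendsto' hlim fun t => ?_
    calc M.μ ⬝ᵥ w ≤ M.μ ⬝ᵥ (expMatrix M β π ^ t *ᵥ w) := dotProduct_mono M.μ_nonneg <| by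
          simpa using le_pow_mulVec (expMatrix_nonneg M β π) hw (Nat.zero_le t)
      _ ≤ M.μ ⬝ᵥ (expMatrix M β π ^ t *ᵥ (sinkInd M + w s₀ • (1 - sinkInd M))) := by
          refine dotProduct_mono M.μ_nonneg <| pow_mulVec_mono (expMatrix_nonneg M β π) t ?_
          intro s
          by_cases hs : s = M.sink
          · simp [hs, sinkInd_sink, hsink]
          · simpa [sinkInd_of_ne M hs] using hs₀ s (Finset.mem_univ s)
      _ = _ := by
          rw [mulVec_add, mulVec_smul, dotProduct_add, dotProduct_smul, smul_eq_mul]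

theorem ermTotal_eq_of_mulVec_eq [DecidableEq S] {M : MDP S A} (hM : Transient M) {β : ℝ}
    (hβ : 0 < β) {π : S → A} {w : S → ℝ} (hw0 : ∀ s, 0 < w s) (hsink : w M.sink = 1)
    (hw : expMatrix M β π *ᵥ w = w) :
    ermTotal M β π = ((-β⁻¹ * Real.log (M.μ ⬝ᵥ w) : ℝ) : EReal) := by
  refine le_antisymm (ermTotal_le_of_le_mulVec hM hβ hw0 hsink hw.ge) ?_
  have hbd : ∀ t : ℕ, M.μ ⬝ᵥ (expMatrix M β π ^ t *ᵥ sinkInd M) ≤ M.μ ⬝ᵥ w := fun t =>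
    dotProduct_mono M.μ_nonneg <|
      (pow_mulVec_mono (expMatrix_nonneg M β π) t
        (sinkInd_le (fun s => (hw0 s).le) hsink.ge)).trans <| by
      simpa using pow_mulVec_le (expMatrix_nonneg M β π) hw.le (Nat.zero_le t)
  rcases weight_dichotomy hM β π with h | ⟨W, hW, h₁, h₂⟩
  · obtain ⟨t, ht⟩ := (h.eventually_gt_atTop (M.μ ⬝ᵥ w)).exists
    exact absurd (hbd t) ht.not_ge
  · rw [ermTotal, (tendsto_erm_coe hW h₁ h₂).liminf_eq, EReal.coe_le_coe_iff, neg_mul, neg_mul,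
      neg_le_neg_iff]
    exact mul_le_mul_of_nonneg_left (Real.log_le_log hW (le_of_tendsto' h₁ hbd))
      (inv_pos.2 hβ).le

variable [Fintype A] [Nonempty A]

/-- Expected exponential weight of one step followed by the values `q`. -/
noncomputable def bellman (M : MDP S A) (β : ℝ) (q : S → A → ℝ) (x : S) (b : A) : ℝ :=
  ∑ x', M.p x b x' * Real.exp (-β * (M.r x b x' + maxQ q x'))

theorem bellman_pos (M : MDP S A) (β : ℝ) (q : S → A → ℝ) (x : S) (b : A) :
    0 < bellman M β q x b := by
  obtain ⟨x', -, hx'⟩ : ∃ x' ∈ Finset.univ, 0 < M.p x b x' :=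
    Finset.exists_lt_of_sum_lt (f := fun _ => (0 : ℝ)) (by simp [M.p_sum])
  exact Finset.sum_pos' (fun x' _ => mul_nonneg (M.p_nonneg _ _ _) (Real.exp_pos _).le)
    ⟨x', Finset.mem_univ x', mul_pos hx' (Real.exp_pos _)⟩

theorem bellman_le_of_le (M : MDP S A) {β : ℝ} (hβ : 0 < β) {q q' : S → A → ℝ} {ε : ℝ}
    (h : ∀ x b, q x b ≤ q' x b + ε) (x : S) (b : A) :
    Real.exp (-β * ε) * bellman M β q' x b ≤ bellman M β q x b := by
  rw [bellman, Finset.mul_sum]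
  refine Finset.sum_le_sum fun x' _ => ?_
  rw [mul_left_comm, ← Real.exp_add]
  refine mul_le_mul_of_nonneg_left (Real.exp_le_exp.2 ?_) (M.p_nonneg _ _ _)
  have : maxQ q x' ≤ maxQ q' x' + ε :=
    maxQ_le_iff.2 fun a => (h x' a).trans (by linarith [le_maxQ q' x' a])
  nlinarith

theorem bellman_eq_mulVec (M : MDP S A) (β : ℝ) (q : S → A → ℝ) (π : S → A) (s : S) :
    bellman M β q s (π s) = (expMatrix M β π *ᵥ fun s => Real.exp (-β * maxQ q s)) s := by
  refine Finset.sum_congr rfl fun s' _ => ?_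
  change _ = M.p s (π s) s' * Real.exp (-β * M.r s (π s) s') * Real.exp (-β * maxQ q s')
  rw [mul_assoc (M.p _ _ _), ← Real.exp_add, mul_add]

theorem bellman_sink (M : MDP S A) (β : ℝ) (q : S → A → ℝ) (b : A) :
    bellman M β q M.sink b = Real.exp (-β * maxQ q M.sink) := by
  rw [bellman, sum_p_sink_mul M b fun x' => Real.exp (-β * (M.r M.sink b x' + maxQ q x')),
    M.r_sink, zero_add]

theorem maxQ_sink_eq_zero {M : MDP S A} {q : S → A → ℝ} (h : ∀ b, q M.sink b = 0) :
    maxQ q M.sink = 0 := by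
  obtain ⟨b, hb⟩ := exists_eq_maxQ q M.sink
  rw [hb, h]

/-- No policy beats the maximum over actions, so this subsolution property holds for every `π`; the
supersolution property needs a greedy one. -/
theorem exp_le_mulVec {M : MDP S A} {β : ℝ} (hβ : 0 < β) {q : S → A → ℝ}
    (hq : ∀ x b, Real.exp (-β * q x b) ≤ bellman M β q x b) (π : S → A) :
    (fun s => Real.exp (-β * maxQ q s)) ≤
      expMatrix M β π *ᵥ fun s => Real.exp (-β * maxQ q s) := by
  intro s
  rw [← bellman_eq_mulVec]
  refine le_trans (Real.exp_le_exp.2 ?_) (hq s (π s))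
  nlinarith [le_maxQ q s (π s)]

variable [DecidableEq S]

/-- Comparison principle for the exponential Bellman equation. -/
theorem le_of_bellman_le {M : MDP S A} (hM : Transient M) {β : ℝ} (hβ : 0 < β)
    {u l : S → A → ℝ} (hu0 : ∀ b, u M.sink b = 0) (hl0 : ∀ b, l M.sink b = 0)
    (hu : ∀ x b, bellman M β u x b ≤ Real.exp (-β * u x b))
    (hl : ∀ x b, Real.exp (-β * l x b) ≤ bellman M β l x b) (x : S) (b : A) : u x b ≤ l x b := by
  -- For a policy greedy for `u` the weights of `u` form a supersolution, those of `l` a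
  -- subsolution.
  choose π hπ using exists_eq_maxQ u
  have h := le_of_mulVec_le hM (β := β) (π := π) (f := fun s => Real.exp (-β * maxQ u s))
    (g := fun s => Real.exp (-β * maxQ l s)) (fun s => Real.exp_pos _)
    (fun s => by
      rw [← bellman_eq_mulVec]
      beta_reduce
      rw [hπ]
      exact hu s (π s)) (exp_le_mulVec hβ hl π)
    (by rw [maxQ_sink_eq_zero hu0, maxQ_sink_eq_zero hl0])
  have h1 : Real.exp (-β * l x b) ≤ Real.exp (-β * u x b) := by
    refine (hl x b).trans (le_trans (Finset.sum_le_sum fun x' _ => ?_) (hu x b))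
    refine mul_le_mul_of_nonneg_left ?_ (M.p_nonneg _ _ _)
    rw [mul_add, mul_add, Real.exp_add, Real.exp_add]
    exact mul_le_mul_of_nonneg_left (h x') (Real.exp_pos _).le
  have h2 := Real.exp_le_exp.1 h1
  nlinarith

section FixedPoint

variable {M : MDP S A} {α β : ℝ} {q : S → A → ℝ}

theorem hVal_le_hEst (hM : Transient M) (hβ : 0 < β) (hq0 : ∀ b, q M.sink b = 0)
    (hq : ∀ x b, Real.exp (-β * q x b) = bellman M β q x b) (π : S → A) :
    hVal M α π β ≤ hEst M α β (some q) := by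
  rw [hVal, hEst, EReal.coe_add]
  exact add_le_add_left (ermTotal_le_of_le_mulVec hM hβ (fun s => Real.exp_pos _)
    (by simp [maxQ_sink_eq_zero hq0]) (exp_le_mulVec hβ (fun x b => (hq x b).le) π)) _

theorem hVal_eq_hEst_of_greedy (hM : Transient M) (hβ : 0 < β) (hq0 : ∀ b, q M.sink b = 0)
    (hq : ∀ x b, Real.exp (-β * q x b) = bellman M β q x b) {π : S → A}
    (hπ : Greedy (some q) π) : hVal M α π β = hEst M α β (some q) := by
  rw [hVal, hEst, EReal.coe_add]
  congr 1
  refine ermTotal_eq_of_mulVec_eq hM hβ (fun s => Real.exp_pos _)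
    (by simp [maxQ_sink_eq_zero hq0]) ?_
  ext s
  rw [← bellman_eq_mulVec, ← hq, maxQ_eq_of_greedy hπ]

theorem hEst_eq_hStar (hM : Transient M) (hβ : 0 < β) (hq0 : ∀ b, q M.sink b = 0)
    (hq : ∀ x b, Real.exp (-β * q x b) = bellman M β q x b) :
    hEst M α β (some q) = hStar M α β := by
  refine le_antisymm ?_ (iSup_le (hVal_le_hEst hM hβ hq0 hq))
  choose π hπ using exists_eq_maxQ q
  rw [← hVal_eq_hEst_of_greedy hM hβ hq0 hq (π := π) fun s a => hπ s ▸ le_maxQ q s a]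
  exact le_iSup (fun π => hVal M α π β) π

end FixedPoint

end Bellman

/-! ### Deterministic analysis of the asynchronous recursion. -/

section StochasticApproximation

/-- Removing the tail of the convergent noise leaves `m` with increments `a i * d i`. Above `θ + 2ε`
it decreases, and by divergence of `∑ a i` it reaches `θ + 3ε`; small steps cannot carry it back
over that level. The last `ε` pays for the noise. -/
theorem eventually_le_of_drift {y a d n : ℕ → ℝ} {θ D N : ℝ}
    (hrec : ∀ᶠ i in atTop, y (i + 1) = y i + a i * d i + n i) (ha : ∀ i, 0 ≤ a i)
    (hasum : ¬ Summable a) (ha0 : Tendsto a atTop (𝓝 0)) (hD : ∀ᶠ i in atTop, d i ≤ D)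
    (hn : Tendsto (fun i => ∑ j ∈ Finset.range i, n j) atTop (𝓝 N))
    (hd : ∀ ε > 0, ∃ κ > 0, ∀ᶠ i in atTop, θ + ε ≤ y i → d i ≤ -κ) :
    ∀ ε > 0, ∀ᶠ i in atTop, y i ≤ θ + ε := by
  intro ε' hε'
  set ε := ε' / 4 with hεdef
  have hε : 0 < ε := by positivity
  obtain ⟨κ, hκ, hdκ⟩ := hd ε hε
  set e : ℕ → ℝ := fun i => ∑ j ∈ Finset.range i, n j - N with he
  have he0 : ∀ᶠ i in atTop, |e i| < ε := by
    have := (hn.sub_const N)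
    rw [sub_self] at this
    simpa [Real.dist_eq] using (Metric.tendsto_nhds.1 this ε hε)
  have haD : ∀ᶠ i in atTop, a i * D < ε := by
    have := ha0.mul_const D
    rw [zero_mul] at this
    exact this.eventually_lt_const hε
  obtain ⟨i₁, hi₁⟩ := eventually_atTop.1 (hrec.and (hdκ.and (he0.and (haD.and hD))))
  set m : ℕ → ℝ := fun i => y i - e i with hm
  have hmrec : ∀ i ≥ i₁, m (i + 1) = m i + a i * d i := by
    intro i hi
    simp only [hm, he, Finset.sum_range_succ, (hi₁ i hi).1]
    ring
  have hneg : ∀ i ≥ i₁, θ + 2 * ε ≤ m i → m (i + 1) ≤ m i - κ * a i := by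
    intro i hi h
    obtain ⟨-, h1, h2, -, -⟩ := hi₁ i hi
    have h3 := h1 (by simp only [hm] at h; linarith [(abs_lt.1 h2).1])
    rw [hmrec i hi]
    nlinarith [ha i]
  have hstay : ∀ i ≥ i₁, m i ≤ θ + 3 * ε → m (i + 1) ≤ θ + 3 * ε := by
    intro i hi h
    rcases le_total (θ + 2 * ε) (m i) with h1 | h1
    · have := hneg i hi h1
      nlinarith [ha i]
    · obtain ⟨-, -, -, h2, h3⟩ := hi₁ i hi
      rw [hmrec i hi]
      have := mul_le_mul_of_nonneg_left h3 (ha i)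
      linarith
  have hreach : ∃ i ≥ i₁, m i ≤ θ + 3 * ε := by
    by_contra! hcon
    have hle : ∀ k, m (k + i₁) ≤ m i₁ - κ * ∑ j ∈ Finset.range k, a (j + i₁) := by
      intro k
      induction k with
      | zero => simp
      | succ k ih =>
        have := hneg (k + i₁) (by omega) (by linarith [hcon (k + i₁) (by omega)])
        rw [Finset.sum_range_succ, mul_add, show k + 1 + i₁ = k + i₁ + 1 by ring]
        linarith
    have hns : ¬ Summable fun j => a (j + i₁) := (summable_nat_add_iff i₁).not.2 hasum
    have htop := (not_summable_iff_tendsto_nat_atTop_of_nonneg fun j => ha (j + i₁)).1 hns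
    obtain ⟨k, hk⟩ := ((htop.const_mul_atTop hκ).eventually_gt_atTop (m i₁ - (θ + 3 * ε))).exists
    linarith [hle k, hcon (k + i₁) (by omega)]
  obtain ⟨i₂, hi₂, hmi₂⟩ := hreach
  refine eventually_atTop.2 ⟨i₂, fun i hi => ?_⟩
  have hmi : m i ≤ θ + 3 * ε := by
    induction i, hi using Nat.le_induction with
    | base => exact hmi₂
    | succ i hi ih => exact hstay i (hi₂.le.trans hi) ih
  have := (hi₁ i (hi₂.le.trans hi)).2.2.1
  simp only [hm] at hmi
  linarith [(abs_lt.1 this).2]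

variable {S A : Type*} [Fintype S] [DecidableEq S] [Fintype A] [Nonempty A]

/-- Bounded iterates that follow the asynchronous ERM Q-learning recursion, up to convergent
noise, converge to a solution of the exponential Bellman equation. -/
theorem exists_tendsto_of_recursion {M : MDP S A} (hM : Transient M) {β : ℝ} (hβ : 0 < β)
    {q a n : ℕ → S → A → ℝ} (hsink : ∀ i b, q i M.sink b = 0)
    (hbdd : ∀ x, ∃ B, ∀ᶠ i in atTop, ∀ b, |q i x b| ≤ B)
    (ha : ∀ i x b, 0 ≤ a i x b)
    (hasum : ∀ x, x ≠ M.sink → ∀ b, ¬ Summable fun i => a i x b)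
    (ha0 : ∀ x, x ≠ M.sink → ∀ b, Tendsto (fun i => a i x b) atTop (𝓝 0))
    (hn : ∀ x, x ≠ M.sink → ∀ b,
      ∃ N, Tendsto (fun i => ∑ j ∈ Finset.range i, n j x b) atTop (𝓝 N))
    (hrec : ∀ x, x ≠ M.sink → ∀ b, ∀ᶠ i in atTop, q (i + 1) x b = q i x b +
      a i x b * (1 - Real.exp (β * q i x b) * bellman M β (q i) x b) + n i x b) :
    ∃ q' : S → A → ℝ, Tendsto q atTop (𝓝 q') ∧ (∀ b, q' M.sink b = 0) ∧
      ∀ x b, Real.exp (-β * q' x b) = bellman M β q' x b := by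
  choose B hB using hbdd
  have hB' : ∀ x b, ∀ᶠ i in atTop, |q i x b| ≤ B x := fun x b => (hB x).mono fun i h => h b
  have hbu : ∀ x b, IsBoundedUnder (· ≤ ·) atTop fun i => q i x b := fun x b =>
    isBoundedUnder_of_eventually_le ((hB' x b).mono fun i h => (abs_le.1 h).2)
  have hbl : ∀ x b, IsBoundedUnder (· ≥ ·) atTop fun i => q i x b := fun x b =>
    isBoundedUnder_of_eventually_ge ((hB' x b).mono fun i h => (abs_le.1 h).1)
  set u : S → A → ℝ := fun x b => limsup (fun i => q i x b) atTop with hu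
  set l : S → A → ℝ := fun x b => liminf (fun i => q i x b) atTop with hl
  have hu0 : ∀ b, u M.sink b = 0 := fun b => by simp [hu, hsink]
  have hl0 : ∀ b, l M.sink b = 0 := fun b => by simp [hl, hsink]
  have hqu : ∀ ε > 0, ∀ᶠ i in atTop, ∀ x b, q i x b ≤ u x b + ε := by
    intro ε hε
    simp only [eventually_all]
    intro x b
    exact (eventually_lt_of_limsup_lt (lt_add_of_pos_right (u x b) hε) (hbu x b)).mono
      fun _ h => h.le
  have hql : ∀ ε > 0, ∀ᶠ i in atTop, ∀ x b, l x b ≤ q i x b + ε := by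
    intro ε hε
    simp only [eventually_all]
    intro x b
    exact (eventually_lt_of_lt_liminf (sub_lt_self (l x b) hε) (hbl x b)).mono
      fun _ h => by linarith
  have hlogexp : ∀ v : S → A → ℝ, ∀ x b,
      Real.exp (-β * (-β⁻¹ * Real.log (bellman M β v x b))) = bellman M β v x b := by
    intro v x b
    rw [← mul_assoc, neg_mul_neg, mul_inv_cancel₀ hβ.ne', one_mul,
      Real.exp_log (bellman_pos M β v x b)]
  -- Let `θ` solve `exp(-β θ) = bellman M β u x b`. Eventually the iterates are below `u + ε/2`, so
  -- at `q ≥ θ + ε` the drift is at most `1 - exp(β ε/2) < 0`; hence `u ≤ θ`.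
  have hub : ∀ x b, bellman M β u x b ≤ Real.exp (-β * u x b) := by
    intro x b
    by_cases hx : x = M.sink
    · rw [hx, bellman_sink, maxQ_sink_eq_zero hu0, hu0]
    obtain ⟨N, hN⟩ := hn x hx b
    set θ := -β⁻¹ * Real.log (bellman M β u x b) with hθ
    have key := eventually_le_of_drift (θ := θ) (D := 1) (y := fun i => q i x b)
      (d := fun i => 1 - Real.exp (β * q i x b) * bellman M β (q i) x b) (hrec x hx b) (fun i => ha i x b)
      (hasum x hx b) (ha0 x hx b) (Eventually.of_forall fun i => by
        have := bellman_pos M β (q i) x b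
        have : 0 < Real.exp (β * q i x b) * bellman M β (q i) x b := by positivity
        linarith) hN ?_
    · have hle : u x b ≤ θ := le_of_forall_pos_le_add fun ε hε =>
        limsup_le_of_le (hbl x b).isCoboundedUnder_le (key ε hε)
      rw [← hlogexp u x b]
      exact Real.exp_le_exp.2 (by nlinarith)
    · intro ε hε
      refine ⟨Real.exp (β * (ε / 2)) - 1, by simpa using by positivity, ?_⟩
      filter_upwards [hqu (ε / 2) (by positivity)] with i hi hy
      have h1 := bellman_le_of_le M hβ hi x b
      rw [← hlogexp u x b, ← hθ, ← Real.exp_add] at h1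
      have h2 : Real.exp (β * (θ + ε)) ≤ Real.exp (β * q i x b) :=
        Real.exp_le_exp.2 (mul_le_mul_of_nonneg_left hy hβ.le)
      have h3 := mul_le_mul h2 h1 (Real.exp_pos _).le (Real.exp_pos _).le
      rw [← Real.exp_add,
        show β * (θ + ε) + (-β * (ε / 2) + -β * θ) = β * (ε / 2) by ring] at h3
      linarith
  have hlb : ∀ x b, Real.exp (-β * l x b) ≤ bellman M β l x b := by
    intro x b
    by_cases hx : x = M.sink
    · rw [hx, bellman_sink, maxQ_sink_eq_zero hl0, hl0]
    obtain ⟨N, hN⟩ := hn x hx b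
    set θ := -β⁻¹ * Real.log (bellman M β l x b) with hθ
    have hbell : ∀ ε > 0, ∀ᶠ i in atTop,
        bellman M β (q i) x b ≤ Real.exp (β * ε) * bellman M β l x b := by
      intro ε hε
      filter_upwards [hql ε hε] with i hi
      have h1 := bellman_le_of_le M hβ hi x b
      rwa [neg_mul, Real.exp_neg, inv_mul_le_iff₀ (Real.exp_pos _)] at h1
    have key := eventually_le_of_drift (θ := -θ) (y := fun i => -q i x b)
      (d := fun i => Real.exp (β * q i x b) * bellman M β (q i) x b - 1)
      (D := Real.exp (β * B x) * (Real.exp (β * 1) * bellman M β l x b))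
      (n := fun i => -n i x b) (N := -N) (a := fun i => a i x b)
      ((hrec x hx b).mono fun i h => by rw [h]; ring) (fun i => ha i x b)
      (hasum x hx b) (ha0 x hx b) ?_ (by simpa using hN.neg) ?_
    · have hle : θ ≤ l x b := le_of_forall_sub_le fun ε hε =>
        le_liminf_of_le (hbu x b).isCoboundedUnder_ge
          ((key ε hε).mono fun i h => by linarith)
      rw [← hlogexp l x b]
      exact Real.exp_le_exp.2 (by nlinarith)
    · filter_upwards [hB' x b, hbell 1 one_pos] with i h1 h2
      have h3 : Real.exp (β * q i x b) ≤ Real.exp (β * B x) :=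
        Real.exp_le_exp.2 (mul_le_mul_of_nonneg_left (abs_le.1 h1).2 hβ.le)
      have := mul_le_mul h3 h2 (bellman_pos M β (q i) x b).le (Real.exp_pos _).le
      linarith
    · intro ε hε
      refine ⟨1 - Real.exp (-(β * (ε / 2))), by simpa using by positivity, ?_⟩
      filter_upwards [hbell (ε / 2) (by positivity)] with i h1 hy
      rw [← hlogexp l x b, ← hθ, ← Real.exp_add] at h1
      have h2 : Real.exp (β * q i x b) ≤ Real.exp (β * (θ - ε)) :=
        Real.exp_le_exp.2 (mul_le_mul_of_nonneg_left (by linarith) hβ.le)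
      have h3 := mul_le_mul h2 h1 (bellman_pos M β (q i) x b).le (Real.exp_pos _).le
      rw [← Real.exp_add,
        show β * (θ - ε) + (β * (ε / 2) + -β * θ) = -(β * (ε / 2)) by ring] at h3
      linarith
  have hul : ∀ x b, l x b = u x b := fun x b =>
    le_antisymm (liminf_le_limsup (hbu x b) (hbl x b)) (le_of_bellman_le hM hβ hu0 hl0 hub hlb x b)
  refine ⟨u, ?_, hu0, fun x b => le_antisymm ?_ (hub x b)⟩
  · rw [tendsto_pi_nhds]
    intro x
    rw [tendsto_pi_nhds]
    intro b
    exact tendsto_of_liminf_eq_limsup (hul x b) rfl (hbu x b) (hbl x b)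
  · rw [← funext₂ hul]
    exact hlb x b

/-- If the residuals of all possible transitions stay bounded along the visits of each
state-action pair, then the iterates stay bounded. -/
theorem eventually_bounded_of_residual {M : MDP S A} (hM : Transient M)
    {q : ℕ → S → A → ℝ} {s : ℕ → S} {a : ℕ → A} {C : ℝ} (hsink : ∀ i b, q i M.sink b = 0)
    (hres : ∀ x, x ≠ M.sink → ∀ b x', 0 < M.p x b x' → ∀ᶠ i in atTop, s i = x → a i = b →
      |M.r x b x' + maxQ (q i) x' - q i x b| ≤ C)
    (hvisit : ∀ x, x ≠ M.sink → ∀ b, ∀ᶠ i in atTop, s i = x → a i = b →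
      |q (i + 1) x b - q i x b| ≤ C)
    (hstay : ∀ x b i, ¬ (s i = x ∧ a i = b) → q (i + 1) x b = q i x b) :
    ∀ x, ∃ B, ∀ᶠ i in atTop, ∀ b, |q i x b| ≤ B := by
  have key : ∀ x, x ≠ M.sink → ∀ b x', 0 < M.p x b x' →
      (∃ B, ∀ᶠ i in atTop, ∀ b, |q i x' b| ≤ B) → ∃ B, ∀ᶠ i in atTop, |q i x b| ≤ B := by
    rintro x hx b x' hp ⟨B, hB⟩
    obtain ⟨i₁, hi₁⟩ := eventually_atTop.1 (hB.and ((hres x hx b x' hp).and (hvisit x hx b)))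
    set V := |M.r x b x'| + B + C with hV
    -- Between visits the entry is frozen. At a visit the residual bound puts the old value within
    -- `V`, and the update moves it by at most `C`.
    refine ⟨max |q i₁ x b| (V + C), eventually_atTop.2 ⟨i₁, fun i hi => ?_⟩⟩
    induction i, hi using Nat.le_induction with
    | base => exact le_max_left _ _
    | succ i hi ih =>
      by_cases hv : s i = x ∧ a i = b
      · refine le_max_of_le_right ?_
        obtain ⟨h1, h2, h3⟩ := hi₁ i hi
        obtain ⟨c, hc⟩ := exists_eq_maxQ (q i) x'
        have h4 := h1 c
        have h5 := h2 hv.1 hv.2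
        have h6 := h3 hv.1 hv.2
        rw [← hc] at h4
        rw [abs_le] at h4 h5 h6 ⊢
        have h7 := neg_abs_le (M.r x b x')
        have h8 := le_abs_self (M.r x b x')
        constructor <;> linarith
      · rwa [hstay x b i hv]
  by_contra! hcon
  have hb : ∀ x, (∀ B, ∃ᶠ i in atTop, ∃ b, B < |q i x b|) →
      ∃ b, ∀ x', 0 < M.p x b x' → ∀ B, ∃ᶠ i in atTop, ∃ b, B < |q i x' b| := by
    intro x hx
    have hxs : x ≠ M.sink := by
      rintro rfl
      obtain ⟨i, b, h⟩ := (hx 0).exists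
      simp [hsink] at h
    by_contra! hno
    have : ∀ b, ∃ B, ∀ᶠ i in atTop, |q i x b| ≤ B := by
      intro b
      obtain ⟨x', hp, B, hB⟩ := hno b
      exact key x hxs b x' hp ⟨B, hB⟩
    choose B hB using this
    obtain ⟨B', hB'⟩ := (Set.finite_range B).bddAbove
    obtain ⟨i, ⟨b, h1⟩, h2⟩ := ((hx B').and_eventually (eventually_all.2 hB)).exists
    exact absurd ((h2 b).trans (hB' ⟨b, rfl⟩)) h1.not_ge
  -- At each unbounded state `π` selects an action all of whose possible successors are unbounded;
  -- the unbounded states are then closed under `π`, yet the sink has value 0.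
  choose! π hπ using hb
  have h := sink_mem_of_closed hM π {x | ∀ B, ∃ᶠ i in atTop, ∃ b, B < |q i x b|} hcon hπ
  obtain ⟨i, b, h⟩ := (h 0).exists
  simp [hsink] at h

end StochasticApproximation

end ExponentialBellman

/-! ### From one sample path to the recursion. -/

section Run

variable {S A : Type*} [Fintype S] [Fintype A] [Nonempty A]

open Classical in
theorem qIter_succ_of_some {M : MDP S A} {β zmin zmax : ℝ} {η : ℕ → ℝ} {s : ℕ → S} {a : ℕ → A}
    {s' : ℕ → S} {i : ℕ} {q q' : S → A → ℝ} (h : qIter M β zmin zmax η s a s' i = some q)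
    (h' : qIter M β zmin zmax η s a s' (i + 1) = some q') :
    tdResidual M q (s i) (a i) (s' i) ∈ Set.Icc zmin zmax ∧
    ∀ x b, q' x b = if s i = x ∧ a i = b then
      q x b - η i * (Real.exp (-β * tdResidual M q (s i) (a i) (s' i)) - 1) else q x b := by
  rw [qIter, h, qStep] at h'
  split_ifs at h' with hz
  refine ⟨hz, fun x b => ?_⟩
  simp only [← Option.some.inj h', eq_comm (a := x), eq_comm (a := b)]

theorem exp_tdResidual (M : MDP S A) (β : ℝ) (q : S → A → ℝ) (x : S) (b : A) (x' : S) :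
    Real.exp (-β * tdResidual M q x b x') =
      Real.exp (β * q x b) * Real.exp (-β * (M.r x b x' + maxQ q x')) := by
  rw [← Real.exp_add, tdResidual]
  congr 1
  ring

open Classical in
/-- Predictable coefficient of the sampling noise of the next state `x'` at the pair `(x, b)`. -/
noncomputable def noiseCoeff (M : MDP S A) (β zmin zmax η : ℝ) (q : S → A → ℝ) (s : S) (a : A)
    (x : S) (b : A) (x' : S) : ℝ :=
  if (s = x ∧ a = b) ∧ tdResidual M q x b x' ∈ Set.Icc zmin zmax then
    η * Real.exp (-β * tdResidual M q x b x') else 0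

theorem exp_le_of_mem_Icc {β zmin zmax z : ℝ} (hβ : 0 < β) (hz : z ∈ Set.Icc zmin zmax) :
    Real.exp (-β * z) ≤ Real.exp (-β * zmin) :=
  Real.exp_le_exp.2 (by nlinarith [hz.1])

open Classical in
theorem noiseCoeff_sq_le (M : MDP S A) {β : ℝ} (hβ : 0 < β) (zmin zmax η : ℝ) (q : S → A → ℝ)
    (s : S) (a : A) (x : S) (b : A) (x' : S) :
    noiseCoeff M β zmin zmax η q s a x b x' ^ 2 ≤
      Real.exp (-β * zmin) ^ 2 * if s = x ∧ a = b then η ^ 2 else 0 := by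
  rw [noiseCoeff]
  split_ifs with h1 h2 h2
  · rw [mul_pow, mul_comm]
    exact mul_le_mul_of_nonneg_right
      (pow_le_pow_left₀ (Real.exp_pos _).le (exp_le_of_mem_Icc hβ h1.2) 2) (sq_nonneg η)
  · exact absurd h1.1 h2
  · rw [zero_pow two_ne_zero]; positivity
  · simp

open Classical in
/-- Along a sample path on which the noise series converge, a run that never stops converges to a
solution of the exponential Bellman equation. -/
theorem exists_tendsto_of_run [DecidableEq S] {M : MDP S A} (hM : Transient M) {β : ℝ}
    (hβ : 0 < β) {zmin zmax : ℝ} {η : ℕ → ℝ} {s : ℕ → S} {a : ℕ → A} {s' : ℕ → S}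
    {q : ℕ → S → A → ℝ} (hrun : ∀ i, qIter M β zmin zmax η s a s' i = some (q i))
    (hη : ∀ i, 0 ≤ η i)
    (hRM : ∀ x : S, x ≠ M.sink → ∀ b : A,
      ¬ Summable (fun i => if s i = x ∧ a i = b then η i else 0) ∧
      Summable (fun i => if s i = x ∧ a i = b then η i ^ 2 else 0))
    (hpos : ∀ i, 0 < M.p (s i) (a i) (s' i))
    (hres : ∀ x b x', 0 < M.p x b x' → ∀ᶠ i in atTop, s i = x → a i = b →
      tdResidual M (q i) x b x' ∈ Set.Icc zmin zmax)
    (hnoise : ∀ x, x ≠ M.sink → ∀ b x', ∃ N, Tendsto (fun i => ∑ j ∈ Finset.range i,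
      noiseCoeff M β zmin zmax (η j) (q j) (s j) (a j) x b x' *
        ((if s' j = x' then 1 else 0) - M.p (s j) (a j) x')) atTop (𝓝 N)) :
    ∃ q' : S → A → ℝ, Tendsto q atTop (𝓝 q') ∧ (∀ b, q' M.sink b = 0) ∧
      ∀ x b, Real.exp (-β * q' x b) = bellman M β q' x b := by
  have hstep := fun i => qIter_succ_of_some (hrun i) (hrun (i + 1))
  have hsink : ∀ i b, q i M.sink b = 0 := by
    intro i
    induction i with
    | zero =>
      intro b
      have h := hrun 0
      rw [qIter] at h
      rw [← Option.some.inj h]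
    | succ i ih =>
      intro b
      rw [(hstep i).2]
      split_ifs with h
      · have h1 : s' i = M.sink := by
          by_contra hne
          have := hpos i
          rw [h.1, p_sink_of_ne M _ hne] at this
          exact this.false
        rw [tdResidual, h1, h.1, M.r_sink, maxQ_sink_eq_zero ih, ih, ih]
        simp
      · exact ih b
  have ha0 : ∀ x, x ≠ M.sink → ∀ b,
      Tendsto (fun i => if s i = x ∧ a i = b then η i else 0) atTop (𝓝 0) := by
    intro x hx b
    have h := ((hRM x hx b).2.tendsto_atTop_zero).sqrt
    rw [Real.sqrt_zero] at h
    refine h.congr fun i => ?_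
    split_ifs
    · exact Real.sqrt_sq (hη i)
    · exact Real.sqrt_zero
  set E := Real.exp (-β * zmin) with hE
  have hbdd := eventually_bounded_of_residual hM (q := q) (s := s) (a := a)
    (C := |zmin| + |zmax| + E + 1) hsink ?_ ?_ ?_
  · refine exists_tendsto_of_recursion hM hβ (a := fun i x b => if s i = x ∧ a i = b then η i else 0)
      (n := fun i x b => -∑ x', noiseCoeff M β zmin zmax (η i) (q i) (s i) (a i) x b x' *
        ((if s' i = x' then 1 else 0) - M.p (s i) (a i) x')) hsink hbdd ?_
      (fun x hx b => (hRM x hx b).1) ha0 ?_ ?_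
    · intro i x b
      split_ifs
      exacts [hη i, le_rfl]
    · intro x hx b
      choose N hN using hnoise x hx b
      refine ⟨-∑ x', N x', ?_⟩
      simp only [Finset.sum_neg_distrib]
      refine Tendsto.neg ?_
      simp only [Finset.sum_comm (s := Finset.range _)]
      exact tendsto_finsetSum _ fun x' _ => hN x'
    · intro x hx b
      have h1 : ∀ᶠ i in atTop, ∀ x', 0 < M.p x b x' → s i = x → a i = b →
          tdResidual M (q i) x b x' ∈ Set.Icc zmin zmax := by
        refine eventually_all.2 fun x' => ?_
        by_cases hp : 0 < M.p x b x'
        · exact (hres x b x' hp).mono fun i h _ => h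
        · exact Eventually.of_forall fun i h => absurd h hp
      filter_upwards [h1] with i hi
      rw [(hstep i).2]
      by_cases hv : s i = x ∧ a i = b
      · have h2 : ∀ x', noiseCoeff M β zmin zmax (η i) (q i) (s i) (a i) x b x' *
            ((if s' i = x' then 1 else 0) - M.p (s i) (a i) x') =
            η i * ((if s' i = x' then Real.exp (-β * tdResidual M (q i) x b x') else 0) -
              Real.exp (β * q i x b) *
                (M.p x b x' * Real.exp (-β * (M.r x b x' + maxQ (q i) x')))) := by
          intro x'
          rw [hv.1, hv.2]
          -- Residuals towards impossible next states may leave the interval, but such states are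
          -- never sampled and contribute zero on both sides.
          rcases (M.p_nonneg x b x').eq_or_lt with hp | hp
          · have : s' i ≠ x' := by
              rintro rfl
              have := hpos i
              rw [hv.1, hv.2, ← hp] at this
              exact this.false
            simp [← hp, this]
          · rw [noiseCoeff, if_pos ⟨⟨rfl, rfl⟩, hi x' hp hv.1 hv.2⟩, exp_tdResidual]
            split_ifs <;> ring
        simp only [h2, if_pos hv, ← Finset.mul_sum, Finset.sum_sub_distrib]
        rw [Finset.sum_ite_eq, if_pos (Finset.mem_univ _), hv.1, hv.2, bellman]
        ring
      · simp [noiseCoeff, hv]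
  · intro x hx b x' hp
    filter_upwards [hres x b x' hp] with i hi h1 h2
    have h := hi h1 h2
    rw [tdResidual] at h
    have hE0 : 0 < E := Real.exp_pos _
    rw [abs_le]
    constructor <;> linarith [h.1, h.2, neg_abs_le zmin, le_abs_self zmax, abs_nonneg zmin,
      abs_nonneg zmax]
  · intro x hx b
    filter_upwards [(ha0 x hx b).eventually_lt_const one_pos] with i hi h1 h2
    rw [if_pos ⟨h1, h2⟩] at hi
    rw [(hstep i).2, if_pos ⟨h1, h2⟩]
    have h3 := exp_le_of_mem_Icc hβ (hstep i).1
    have h4 := Real.exp_pos (-β * tdResidual M (q i) (s i) (a i) (s' i))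
    have h5 := hη i
    have h6 := abs_nonneg zmin
    have h7 := abs_nonneg zmax
    have h8 : |Real.exp (-β * tdResidual M (q i) (s i) (a i) (s' i)) - 1| ≤ E + 1 := by
      rw [abs_le]
      constructor <;> linarith
    rw [sub_sub_cancel_left, abs_neg, abs_mul, abs_of_nonneg h5]
    calc _ ≤ 1 * (E + 1) := mul_le_mul hi.le h8 (abs_nonneg _) zero_le_one
      _ ≤ _ := by linarith
  · intro x b i h
    rw [(hstep i).2, if_neg h]

end Run

/-! ### Convergence of martingale transforms. -/

section MartingaleTransform

variable {Ω : Type*} {mΩ : MeasurableSpace Ω} {P : Measure Ω} [IsProbabilityMeasure P]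

theorem integrable_of_abs_le {f : Ω → ℝ} (hf : Measurable f) {K : ℝ} (hK : ∀ ω, |f ω| ≤ K) :
    Integrable f P :=
  Integrable.of_bound hf.aestronglyMeasurable K (Eventually.of_forall hK)

/-- A martingale transform of bounded martingale differences by bounded predictable coefficients
with bounded sum of squares converges. -/
theorem ae_tendsto_sum_of_sq_sum_le (ℱ : Filtration ℕ mΩ) {c ξ : ℕ → Ω → ℝ} {N : ℝ}
    (hc : ∀ i, Measurable[ℱ i] (c i)) (hξ : ∀ i, Measurable[ℱ (i + 1)] (ξ i))
    (hb : ∀ i ω, |ξ i ω| ≤ 1) (hm : ∀ i, P[ξ i|ℱ i] =ᵐ[P] 0)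
    (hsum : ∀ n ω, ∑ j ∈ Finset.range n, c j ω ^ 2 ≤ N) :
    ∀ᵐ ω ∂P, ∃ l, Tendsto (fun i => ∑ j ∈ Finset.range i, c j ω * ξ j ω) atTop (𝓝 l) := by
  have hc' : ∀ i, Measurable (c i) := fun i => (hc i).mono (ℱ.le i) le_rfl
  have hξ' : ∀ i, Measurable (ξ i) := fun i => (hξ i).mono (ℱ.le _) le_rfl
  have hN0 : 0 ≤ N := by
    obtain ⟨ω⟩ := nonempty_of_isProbabilityMeasure P
    simpa using hsum 0 ω
  have hcb : ∀ i ω, |c i ω| ≤ N + 1 := by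
    intro i ω
    have h1 := Finset.single_le_sum (f := fun j => c j ω ^ 2) (fun j _ => sq_nonneg _)
      (Finset.self_mem_range_succ i)
    have h2 := h1.trans (hsum (i + 1) ω)
    rw [← sq_abs] at h2
    nlinarith [abs_nonneg (c i ω), sq_nonneg (|c i ω| - 1)]
  set X : ℕ → Ω → ℝ := fun n ω => ∑ j ∈ Finset.range n, c j ω * ξ j ω with hX
  have hXm : ∀ n, Measurable[ℱ n] (X n) := by
    intro n
    refine Finset.measurable_fun_sum _ fun j hj => ?_
    have hj := Finset.mem_range.1 hj
    exact ((hc j).mono (ℱ.mono hj.le) le_rfl).mul ((hξ j).mono (ℱ.mono hj) le_rfl)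
  have hXm' : ∀ n, Measurable (X n) := fun n => (hXm n).mono (ℱ.le n) le_rfl
  have hcξ : ∀ i ω, |c i ω * ξ i ω| ≤ N + 1 := by
    intro i ω
    rw [abs_mul]
    exact (mul_le_of_le_one_right (abs_nonneg _) (hb i ω)).trans (hcb i ω)
  have hXb : ∀ n ω, |X n ω| ≤ n * (N + 1) := by
    intro n ω
    refine (Finset.abs_sum_le_sum_abs _ _).trans ?_
    refine (Finset.sum_le_card_nsmul _ _ _ fun j _ => hcξ j ω).trans ?_
    rw [Finset.card_range, nsmul_eq_mul]
  have hXint : ∀ n, Integrable (X n) P := fun n => integrable_of_abs_le (hXm' n) (hXb n)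
  have hξint : ∀ n, Integrable (ξ n) P := fun n => integrable_of_abs_le (hξ' n) (hb n)
  have hce : ∀ i (f : Ω → ℝ), Measurable[ℱ i] f → ∀ K, (∀ ω, |f ω| ≤ K) →
      P[f * ξ i|ℱ i] =ᵐ[P] 0 := by
    intro i f hf K hK
    refine (condExp_stronglyMeasurable_mul_of_bound (ℱ.le i) hf.stronglyMeasurable (hξint i) K
      (Eventually.of_forall hK)).trans ?_
    filter_upwards [hm i] with ω hω
    simp [hω]
  have hmart : Martingale X ℱ P := by
    refine martingale_of_condExp_sub_eq_zero_nat (fun n => (hXm n).stronglyMeasurable) hXint ?_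
    intro i
    have : X (i + 1) - X i = c i * ξ i := by
      ext ω
      simp [hX, Finset.sum_range_succ]
    rw [this]
    exact hce i (c i) (hc i) _ (hcb i)
  -- Increments are orthogonal to the past. The resulting `L²` bound gives the `L¹` bound of the
  -- martingale convergence theorem.
  have hsq : ∀ n, ∫ ω, X n ω ^ 2 ∂P ≤ ∫ ω, ∑ j ∈ Finset.range n, c j ω ^ 2 ∂P := by
    intro n
    induction n with
    | zero => simp [hX]
    | succ n ih =>
      have hI1 : Integrable (fun ω => X n ω ^ 2) P :=
        integrable_of_abs_le ((hXm' n).pow_const 2) (K := (n * (N + 1)) ^ 2) fun ω => by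
          rw [abs_pow]; exact pow_le_pow_left₀ (abs_nonneg _) (hXb n ω) 2
      have hI2 : Integrable ((X n * c n) * ξ n) P :=
        integrable_of_abs_le (((hXm' n).mul (hc' n)).mul (hξ' n)) (K := n * (N + 1) * (N + 1))
          fun ω => by
            rw [Pi.mul_apply, Pi.mul_apply, mul_assoc, abs_mul]
            exact mul_le_mul (hXb n ω) (hcξ n ω) (abs_nonneg _) (by positivity)
      have hI3 : Integrable (fun ω => c n ω ^ 2) P :=
        integrable_of_abs_le ((hc' n).pow_const 2) (K := (N + 1) ^ 2) fun ω => by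
          rw [abs_pow]; exact pow_le_pow_left₀ (abs_nonneg _) (hcb n ω) 2
      have hI4 : Integrable (fun ω => ∑ j ∈ Finset.range n, c j ω ^ 2) P :=
        integrable_of_abs_le (Finset.measurable_fun_sum _ fun j _ => (hc' j).pow_const 2) (K := N)
          fun ω => by
            rw [abs_of_nonneg (Finset.sum_nonneg fun j _ => sq_nonneg _)]
            exact hsum n ω
      have hzero : ∫ ω, ((X n * c n) * ξ n) ω ∂P = 0 := by
        rw [← integral_condExp (ℱ.le n),
          integral_congr_ae (hce n (X n * c n) ((hXm n).mul (hc n)) (n * (N + 1) * (N + 1))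
            fun ω => by
              rw [Pi.mul_apply, abs_mul]
              exact mul_le_mul (hXb n ω) (hcb n ω) (abs_nonneg _) (by positivity))]
        simp
      have hle : ∀ ω, X (n + 1) ω ^ 2 ≤ X n ω ^ 2 + 2 * ((X n * c n) * ξ n) ω + c n ω ^ 2 := by
        intro ω
        have h1 : X (n + 1) ω = X n ω + c n ω * ξ n ω := by simp [hX, Finset.sum_range_succ]
        have h2 : c n ω ^ 2 * ξ n ω ^ 2 ≤ c n ω ^ 2 :=
          mul_le_of_le_one_right (sq_nonneg _) ((sq_le_one_iff_abs_le_one _).2 (hb n ω))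
        rw [h1, Pi.mul_apply, Pi.mul_apply]
        nlinarith
      have hI5 : Integrable (fun ω => X (n + 1) ω ^ 2) P :=
        integrable_of_abs_le ((hXm' (n + 1)).pow_const 2) (K := ((n + 1 : ℕ) * (N + 1)) ^ 2)
          fun ω => by
            rw [abs_pow]; exact pow_le_pow_left₀ (abs_nonneg _) (hXb (n + 1) ω) 2
      calc ∫ ω, X (n + 1) ω ^ 2 ∂P
          ≤ ∫ ω, X n ω ^ 2 + 2 * ((X n * c n) * ξ n) ω + c n ω ^ 2 ∂P :=
            integral_mono hI5 ((hI1.add (hI2.const_mul 2)).add hI3) hle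
        _ = ∫ ω, X n ω ^ 2 ∂P + 2 * ∫ ω, ((X n * c n) * ξ n) ω ∂P + ∫ ω, c n ω ^ 2 ∂P := by
            rw [← integral_const_mul, ← integral_add hI1 (hI2.const_mul 2)]
            exact integral_add (hI1.add (hI2.const_mul 2)) hI3
        _ ≤ ∫ ω, ∑ j ∈ Finset.range n, c j ω ^ 2 ∂P + ∫ ω, c n ω ^ 2 ∂P := by
            rw [hzero]; linarith
        _ = _ := by
            simp only [Finset.sum_range_succ]
            rw [integral_add hI4 hI3]
  refine hmart.submartingale.exists_ae_tendsto_of_bdd (R := (1 + N).toNNReal) fun n => ?_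
  rw [eLpNorm_one_eq_lintegral_enorm, ← ofReal_integral_norm_eq_lintegral_enorm (hXint n)]
  refine ENNReal.ofReal_le_ofReal ?_
  have hI : Integrable (fun ω => X n ω ^ 2) P :=
    integrable_of_abs_le ((hXm' n).pow_const 2) (K := (n * (N + 1)) ^ 2) fun ω => by
      rw [abs_pow]; exact pow_le_pow_left₀ (abs_nonneg _) (hXb n ω) 2
  have hIN : ∫ ω, ∑ j ∈ Finset.range n, c j ω ^ 2 ∂P ≤ ∫ _, N ∂P := by
    refine integral_mono_of_nonneg (Eventually.of_forall fun ω =>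
      Finset.sum_nonneg fun j _ => sq_nonneg _) (integrable_const N)
      (Eventually.of_forall fun ω => hsum n ω)
  calc ∫ ω, ‖X n ω‖ ∂P ≤ ∫ ω, 1 + X n ω ^ 2 ∂P := by
        refine integral_mono (hXint n).norm ((integrable_const 1).add hI) fun ω => ?_
        simp only [Real.norm_eq_abs]
        nlinarith [sq_abs (X n ω), sq_nonneg (|X n ω| - 1), abs_nonneg (X n ω)]
    _ = 1 + ∫ ω, X n ω ^ 2 ∂P := by
        rw [integral_add (integrable_const 1) hI]
        simp
    _ ≤ 1 + N := by
        simp only [integral_const, probReal_univ, one_smul] at hIN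
        linarith [hsq n]

/-- A martingale transform of bounded martingale differences converges where the squares of the
predictable coefficients are summable. -/
theorem ae_tendsto_sum_of_sq_summable (ℱ : Filtration ℕ mΩ) {c ξ : ℕ → Ω → ℝ}
    (hc : ∀ i, Measurable[ℱ i] (c i)) (hξ : ∀ i, Measurable[ℱ (i + 1)] (ξ i))
    (hb : ∀ i ω, |ξ i ω| ≤ 1) (hm : ∀ i, P[ξ i|ℱ i] =ᵐ[P] 0)
    (hsum : ∀ᵐ ω ∂P, Summable fun i => c i ω ^ 2) :
    ∀ᵐ ω ∂P, ∃ l, Tendsto (fun i => ∑ j ∈ Finset.range i, c j ω * ξ j ω) atTop (𝓝 l) := by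
  classical
  -- The test includes the index `i` itself: `c i` is already known at time `i`, and so the
  -- truncated sum of squares never exceeds `N`.
  set T : ℕ → ℕ → Ω → ℝ := fun N i ω =>
    if ∑ j ∈ Finset.range (i + 1), c j ω ^ 2 ≤ N then c i ω else 0 with hT
  have hTm : ∀ N i, Measurable[ℱ i] (T N i) := by
    intro N i
    have hS : Measurable[ℱ i] fun ω => ∑ j ∈ Finset.range (i + 1), c j ω ^ 2 :=
      Finset.measurable_fun_sum _ fun j hj =>
        ((hc j).mono (ℱ.mono (Nat.lt_succ_iff.1 (Finset.mem_range.1 hj))) le_rfl).pow_const 2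
    exact Measurable.ite (hS measurableSet_Iic) (hc i) measurable_const
  have hTsum : ∀ N n ω, ∑ j ∈ Finset.range n, T N j ω ^ 2 ≤ N := by
    intro N n ω
    induction n with
    | zero => simp
    | succ n ih =>
      by_cases h : ∑ j ∈ Finset.range (n + 1), c j ω ^ 2 ≤ N
      · refine le_trans (Finset.sum_le_sum fun j _ => ?_) h
        simp only [hT]
        split_ifs
        · exact le_rfl
        · rw [zero_pow two_ne_zero]; exact sq_nonneg _
      · rw [Finset.sum_range_succ]
        have : T N n ω = 0 := if_neg h
        rw [this]
        simpa using ih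
  have h := fun N => ae_tendsto_sum_of_sq_sum_le ℱ (hTm N) hξ hb hm (hTsum N)
  filter_upwards [ae_all_iff.2 h, hsum] with ω h1 h2
  obtain ⟨N, hN⟩ := exists_nat_ge (∑' i, c i ω ^ 2)
  obtain ⟨l, hl⟩ := h1 N
  refine ⟨l, hl.congr fun i => Finset.sum_congr rfl fun j _ => ?_⟩
  have : T N j ω = c j ω :=
    if_pos ((h2.sum_le_tsum _ fun _ _ => sq_nonneg _).trans hN)
  rw [this]

end MartingaleTransform

/-! ### Measurability with respect to the history. -/

section History

variable {S A Ω : Type*} {η : ℕ → Ω → ℝ} {s : ℕ → Ω → S} {a : ℕ → Ω → A} {s' : ℕ → Ω → S}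

theorem measurable_apply_finite {m : MeasurableSpace Ω} {X Y : Type*} [MeasurableSpace Y]
    [Finite X] {D : Ω → X} (hD : Measurable[m, ⊤] D) {f : X → Ω → Y}
    (hf : ∀ d, Measurable[m] (f d)) : Measurable[m] fun ω => f (D ω) ω := by
  intro t ht
  have : (fun ω => f (D ω) ω) ⁻¹' t = ⋃ d, D ⁻¹' {d} ∩ f d ⁻¹' t := by
    ext ω
    simp
  rw [this]
  exact MeasurableSet.iUnion fun d => (hD trivial).inter (hf d ht)
theorem measurable_step_history (i : ℕ) : Measurable[history η s a s' i] (η i) :=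
  measurable_iff_comap_le.2 (le_trans (le_trans le_sup_left le_sup_left) le_sup_left)

theorem measurable_state_history (i : ℕ) : Measurable[history η s a s' i, ⊤] (s i) :=
  measurable_iff_comap_le.2 (le_trans (le_trans le_sup_right le_sup_left) le_sup_left)

theorem measurable_action_history (i : ℕ) : Measurable[history η s a s' i, ⊤] (a i) :=
  measurable_iff_comap_le.2 (le_trans le_sup_right le_sup_left)

theorem past_le_history {i l : ℕ} (h : l < i) :
    MeasurableSpace.comap (η l) inferInstance ⊔ MeasurableSpace.comap (s l) ⊤ ⊔
      MeasurableSpace.comap (a l) ⊤ ⊔ MeasurableSpace.comap (s' l) ⊤ ≤ history η s a s' i :=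
  le_trans (le_iSup (fun l : Fin i => MeasurableSpace.comap (η l) inferInstance ⊔
    MeasurableSpace.comap (s l) ⊤ ⊔ MeasurableSpace.comap (a l) ⊤ ⊔
    MeasurableSpace.comap (s' l) ⊤) ⟨l, h⟩) le_sup_right

theorem measurable_next_history {i l : ℕ} (h : l < i) :
    Measurable[history η s a s' i, ⊤] (s' l) :=
  measurable_iff_comap_le.2 (le_trans le_sup_right (past_le_history h))

theorem history_mono : Monotone (history η s a s') := by
  intro i j hij
  rcases hij.eq_or_lt with rfl | hij
  · exact le_rfl
  · exact sup_le (le_sup_left.trans (past_le_history hij))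
      (iSup_le fun l => past_le_history (l.2.trans hij))

theorem measurable_transition [Fintype S] [Finite A] {M : MDP S A} (i : ℕ) (x : S) :
    Measurable[history η s a s' i] fun ω => M.p (s i ω) (a i ω) x :=
  measurable_apply_finite (f := fun y ω => M.p y (a i ω) x) (measurable_state_history i)
    fun y => measurable_apply_finite (f := fun b _ => M.p y b x) (measurable_action_history i)
      fun _ => measurable_const

end History

/-! ### Probabilistic consequences of the transition law. -/

section Stream

variable {S A Ω : Type*} [mΩ : MeasurableSpace Ω] [Fintype S] {M : MDP S A} {P : Measure Ω}
  {η : ℕ → Ω → ℝ} {s : ℕ → Ω → S} {a : ℕ → Ω → A} {s' : ℕ → Ω → S}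

theorem IsSampleStream.history_le (h : IsSampleStream M P η s a s') (i : ℕ) :
    history η s a s' i ≤ mΩ := by
  refine sup_le (sup_le (sup_le ?_ ?_) ?_)
    (iSup_le fun l => sup_le (sup_le (sup_le ?_ ?_) ?_) ?_)
  exacts [(h.measurable_step _).comap_le, (h.measurable_state _).comap_le,
    (h.measurable_action _).comap_le, (h.measurable_step _).comap_le,
    (h.measurable_state _).comap_le, (h.measurable_action _).comap_le,
    (h.measurable_next _).comap_le]

/-- The filtration generated by a sample stream. -/
def IsSampleStream.filtration (h : IsSampleStream M P η s a s') : Filtration ℕ mΩ where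
  seq := history η s a s'
  mono' := history_mono
  le' := h.history_le

theorem IsSampleStream.measurableSet_next (h : IsSampleStream M P η s a s') (i : ℕ) (x : S) :
    MeasurableSet {ω | s' i ω = x} :=
  h.measurable_next i (t := {x}) trivial

variable [IsProbabilityMeasure P]

theorem IsSampleStream.integrable_next (h : IsSampleStream M P η s a s') (i : ℕ) (x : S) :
    Integrable (Set.indicator {ω | s' i ω = x} (fun _ => (1 : ℝ))) P :=
  (integrable_const 1).indicator (h.measurableSet_next i x)

theorem p_le_one (M : MDP S A) (x : S) (b : A) (x' : S) : M.p x b x' ≤ 1 := by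
  rw [← M.p_sum x b]
  exact Finset.single_le_sum (f := M.p x b) (fun _ _ => M.p_nonneg _ _ _) (Finset.mem_univ x')

theorem IsSampleStream.ae_pos [Finite A] (h : IsSampleStream M P η s a s') :
    ∀ᵐ ω ∂P, ∀ i, 0 < M.p (s i ω) (a i ω) (s' i ω) := by
  have key : ∀ i x, ∀ᵐ ω ∂P, M.p (s i ω) (a i ω) x = 0 → s' i ω ≠ x := by
    intro i x
    set D : Set Ω := {ω | M.p (s i ω) (a i ω) x = 0} with hD
    have hDm : MeasurableSet[history η s a s' i] D :=
      measurable_transition i x (measurableSet_singleton 0)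
    have h1 := setIntegral_condExp (h.history_le i) (h.integrable_next i x) hDm
    rw [setIntegral_congr_ae (g := fun _ => (0 : ℝ)) (h.history_le i _ hDm)
      ((h.transition i x).mono fun ω hω hωD => hω.trans hωD), integral_zero,
      setIntegral_indicator (h.measurableSet_next i x)] at h1
    simp only [integral_const, smul_eq_mul, mul_one, measureReal_restrict_apply_univ] at h1
    have h2 : P (D ∩ {ω | s' i ω = x}) = 0 :=
      (measureReal_eq_zero_iff (measure_ne_top _ _)).1 h1.symm
    filter_upwards [measure_eq_zero_iff_ae_notMem.1 h2] with ω hω h3 h4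
    exact hω ⟨h3, h4⟩
  filter_upwards [ae_all_iff.2 fun i => ae_all_iff.2 (key i)] with ω hω i
  exact (M.p_nonneg _ _ _).lt_of_ne' fun h0 => hω i _ h0 rfl

open Classical in
theorem IsSampleStream.ae_tendsto_noise [Finite A] (h : IsSampleStream M P η s a s') (x : S)
    {c : ℕ → Ω → ℝ} (hc : ∀ i, Measurable[history η s a s' i] (c i))
    (hsum : ∀ᵐ ω ∂P, Summable fun i => c i ω ^ 2) :
    ∀ᵐ ω ∂P, ∃ l, Tendsto (fun i => ∑ j ∈ Finset.range i, c j ω *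
      ((if s' j ω = x then 1 else 0) - M.p (s j ω) (a j ω) x)) atTop (𝓝 l) := by
  refine ae_tendsto_sum_of_sq_summable h.filtration hc (fun i => ?_) (fun i ω => ?_) (fun i => ?_)
    hsum
  · refine Measurable.sub (Measurable.ite ?_ measurable_const measurable_const)
      ((measurable_transition i x).mono (history_mono i.le_succ) le_rfl)
    exact measurable_next_history i.lt_succ_self (t := {x}) trivial
  · have h1 := M.p_nonneg (s i ω) (a i ω) x
    have h2 := p_le_one M (s i ω) (a i ω) x
    rw [abs_le]
    split_ifs <;> constructor <;> linarith
  · have hpm : Measurable[history η s a s' i] fun ω => M.p (s i ω) (a i ω) x :=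
      measurable_transition i x
    have hint : Integrable (fun ω => M.p (s i ω) (a i ω) x) P :=
      integrable_of_abs_le (hpm.mono (h.history_le i) le_rfl) (K := 1) fun ω => by
        rw [abs_of_nonneg (M.p_nonneg _ _ _)]
        exact p_le_one M _ _ _
    have h1 := condExp_sub (h.integrable_next i x) hint (history η s a s' i)
    rw [condExp_of_stronglyMeasurable (h.history_le i) hpm.stronglyMeasurable hint] at h1
    have h2 : (fun ω => (if s' i ω = x then (1 : ℝ) else 0) - M.p (s i ω) (a i ω) x) =
        Set.indicator {ω | s' i ω = x} (fun _ => (1 : ℝ)) - fun ω => M.p (s i ω) (a i ω) x := by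
      ext ω
      simp [Set.indicator_apply]
    rw [h2]
    filter_upwards [h1, h.transition i x] with ω h3 h4
    rw [show (h.filtration i : MeasurableSpace Ω) = history η s a s' i from rfl, h3, Pi.sub_apply,
      h4, sub_self, Pi.zero_apply]

/-- Conditional Borel–Cantelli lemma for sample streams: visits of a pair with a past-dependent
property after which a possible next state is never sampled occur only finitely often. -/
theorem IsSampleStream.ae_eventually_notMem [Finite A] (h : IsSampleStream M P η s a s')
    {x : S} {b : A} {x' : S} (hp : 0 < M.p x b x') {D : ℕ → Set Ω}
    (hD : ∀ i, MeasurableSet[history η s a s' i] (D i))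
    (hDsub : ∀ i, ∀ ω ∈ D i, s i ω = x ∧ a i ω = b) :
    ∀ᵐ ω ∂P, (∀ i, ω ∈ D i → s' i ω ≠ x') → ∀ᶠ i in atTop, ω ∉ D i := by
  classical
  -- The shift by one is needed since `s' i` is known only at time `i + 1`. On `D i` the conditional
  -- probability of `E (i + 1)` is the constant `M.p x b x' > 0`.
  set E : ℕ → Set Ω := fun n => Nat.casesOn n ∅ fun i => D i ∩ {ω | s' i ω = x'} with hE
  have hEm : ∀ n, MeasurableSet[h.filtration n] (E n) := by
    intro n
    cases n with
    | zero => exact @MeasurableSet.empty _ (history η s a s' 0)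
    | succ i =>
      refine MeasurableSet.inter (history_mono i.le_succ _ (hD i)) ?_
      exact measurable_next_history i.lt_succ_self (t := {x'}) trivial
  have hce : ∀ i, P[(E (i + 1)).indicator (1 : Ω → ℝ)|h.filtration i] =ᵐ[P]
      fun ω => if ω ∈ D i then M.p x b x' else 0 := by
    intro i
    have h1 : (E (i + 1)).indicator (1 : Ω → ℝ) =
        (D i).indicator (Set.indicator {ω | s' i ω = x'} (fun _ => (1 : ℝ))) := by
      rw [Set.indicator_indicator]
      rfl
    rw [h1]
    refine (condExp_indicator (h.integrable_next i x') (hD i)).trans ?_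
    filter_upwards [h.transition i x'] with ω hω
    rw [Set.indicator_apply]
    refine if_ctx_congr Iff.rfl (fun hωD => ?_) fun _ => rfl
    rw [← (hDsub i ω hωD).1, ← (hDsub i ω hωD).2]
    exact hω
  filter_upwards [ae_mem_limsup_atTop_iff P hEm, ae_all_iff.2 hce] with ω h1 h2 h3
  by_contra hcon
  have hnot : ω ∉ limsup E atTop := by
    rw [mem_limsup_iff_frequently_mem]
    refine not_frequently.2 (Eventually.of_forall fun n hn => ?_)
    cases n with
    | zero => exact hn
    | succ i => exact h3 i hn.1 hn.2
  refine hnot (h1.2 ?_)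
  simp only [h2]
  refine (not_summable_iff_tendsto_nat_atTop_of_nonneg fun i => ?_).1 fun hs => hcon ?_
  · split_ifs
    exacts [hp.le, le_rfl]
  · filter_upwards [hs.tendsto_atTop_zero.eventually_lt_const hp] with i hi hmem
    rw [if_pos hmem] at hi
    exact hi.false

end Stream

/-! ### Adaptedness of the iterates. -/

section RunMeasurability

variable {S A Ω : Type*} [Fintype S] [Fintype A] [Nonempty A] {M : MDP S A}

theorem measurable_tdResidual {m : MeasurableSpace Ω} {V : Ω → S → A → ℝ}
    (hV : ∀ x b, Measurable[m] fun ω => V ω x b) (x : S) (b : A) (x' : S) :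
    Measurable[m] fun ω => tdResidual M (V ω) x b x' := by
  refine Measurable.sub (Measurable.add measurable_const ?_) (hV x b)
  have h : (fun ω => maxQ (V ω) x') =
      Finset.univ.sup' Finset.univ_nonempty fun a ω => V ω x' a := by
    ext ω
    rw [maxQ, Finset.sup'_apply]
  rw [h]
  exact Finset.measurable_sup' _ fun a _ => hV x' a

variable {η : ℕ → Ω → ℝ} {s : ℕ → Ω → S} {a : ℕ → Ω → A} {s' : ℕ → Ω → S}

theorem measurable_qIter (M : MDP S A) (β zmin zmax : ℝ) (i : ℕ) :
    MeasurableSet[history η s a s' i] {ω | (qIter M β zmin zmax (fun j => η j ω)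
      (fun j => s j ω) (fun j => a j ω) (fun j => s' j ω) i).isSome} ∧
    ∀ x b, Measurable[history η s a s' i] fun ω => (qIter M β zmin zmax (fun j => η j ω)
      (fun j => s j ω) (fun j => a j ω) (fun j => s' j ω) i).getD 0 x b := by
  classical
  induction i with
  | zero =>
    simp only [qIter, Option.isSome_some, Set.ofPred_true, Option.getD_some]
    exact ⟨@MeasurableSet.univ _ (history η s a s' 0), fun _ _ => measurable_const⟩
  | succ i ih =>
    obtain ⟨ih1, ih2⟩ := ih
    set R : ℕ → Ω → Option (S → A → ℝ) := fun i ω => qIter M β zmin zmax (fun j => η j ω)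
      (fun j => s j ω) (fun j => a j ω) (fun j => s' j ω) i with hR
    have hle : history η s a s' i ≤ history η s a s' (i + 1) := history_mono i.le_succ
    have hz : Measurable[history η s a s' (i + 1)] fun ω =>
        tdResidual M ((R i ω).getD 0) (s i ω) (a i ω) (s' i ω) :=
      measurable_apply_finite (f := fun x ω => tdResidual M ((R i ω).getD 0) x (a i ω) (s' i ω))
        ((measurable_state_history i).mono hle le_rfl) fun x =>
      measurable_apply_finite (f := fun b ω => tdResidual M ((R i ω).getD 0) x b (s' i ω))
        ((measurable_action_history i).mono hle le_rfl) fun b =>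
      measurable_apply_finite (f := fun x' ω => tdResidual M ((R i ω).getD 0) x b x')
        (measurable_next_history i.lt_succ_self) fun x' =>
      (measurable_tdResidual ih2 x b x').mono hle le_rfl
    have hsome : MeasurableSet[history η s a s' (i + 1)] {ω | (R (i + 1) ω).isSome} := by
      have : {ω | (R (i + 1) ω).isSome} = {ω | (R i ω).isSome} ∩
          (fun ω => tdResidual M ((R i ω).getD 0) (s i ω) (a i ω) (s' i ω)) ⁻¹'
            Set.Icc zmin zmax := by
        ext ω
        simp only [Set.mem_ofPred_eq, Set.mem_inter_iff, Set.mem_preimage, Set.mem_Icc]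
        change (qStep _ _ _ _ _ _ _ _ (R i ω)).isSome = true ↔ _
        cases R i ω with
        | none => simp [qStep]
        | some q =>
          simp only [qStep, Option.isSome_some, Option.getD_some, true_and]
          split_ifs with h <;> simp [h]
      rw [this]
      exact MeasurableSet.inter (hle _ ih1) (hz measurableSet_Icc)
    refine ⟨hsome, fun x b => ?_⟩
    have hval : (fun ω => (R (i + 1) ω).getD 0 x b) = fun ω => if (R (i + 1) ω).isSome then
        (if s i ω = x ∧ a i ω = b then (R i ω).getD 0 x b - η i ω *
          (Real.exp (-β * tdResidual M ((R i ω).getD 0) (s i ω) (a i ω) (s' i ω)) - 1)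
        else (R i ω).getD 0 x b) else 0 := by
      ext ω
      cases h' : R (i + 1) ω with
      | none => simp
      | some q' =>
        cases h : R i ω with
        | none =>
          have : R (i + 1) ω = none := by
            change qStep _ _ _ _ _ _ _ _ (R i ω) = _
            rw [h, qStep]
          simp [this] at h'
        | some q => simpa using (qIter_succ_of_some h h').2 x b
    change Measurable[history η s a s' (i + 1)] fun ω => (R (i + 1) ω).getD 0 x b
    rw [hval]
    have hold : Measurable[history η s a s' (i + 1)] fun ω => (R i ω).getD 0 x b :=
      (ih2 x b).mono hle le_rfl
    refine Measurable.ite hsome (Measurable.ite ?_ ?_ hold) measurable_const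
    · exact MeasurableSet.inter
        (hle _ (measurable_state_history i (t := {x}) trivial))
        (hle _ (measurable_action_history i (t := {b}) trivial))
    · exact hold.sub (((measurable_step_history i).mono hle le_rfl).mul
        ((Real.measurable_exp.comp (measurable_const.mul hz)).sub measurable_const))

end RunMeasurability

/-! ### Almost sure convergence of the runs. -/

section Convergence

variable {S A Ω : Type*} [mΩ : MeasurableSpace Ω] [Fintype S] [DecidableEq S] [Fintype A]
  [Nonempty A] {M : MDP S A} {P : Measure Ω} [IsProbabilityMeasure P]
  {η : ℕ → Ω → ℝ} {s : ℕ → Ω → S} {a : ℕ → Ω → A} {s' : ℕ → Ω → S}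

/-- Almost surely, a run of ERM Q-learning that never stops converges to a solution of the
exponential Bellman equation. -/
theorem ae_exists_tendsto_of_run (hM : Transient M) (h : IsSampleStream M P η s a s')
    (hRM : RobbinsMonro M P η s a) {β : ℝ} (hβ : 0 < β) (zmin zmax : ℝ) :
    ∀ᵐ ω ∂P, ∀ q : ℕ → S → A → ℝ,
      (∀ i, qIter M β zmin zmax (fun j => η j ω) (fun j => s j ω) (fun j => a j ω)
        (fun j => s' j ω) i = some (q i)) →
      ∃ q' : S → A → ℝ, Tendsto q atTop (𝓝 q') ∧ (∀ b, q' M.sink b = 0) ∧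
        ∀ x b, Real.exp (-β * q' x b) = bellman M β q' x b := by
  classical
  -- The default 0 after stopping only makes the process total and adapted; on runs that never stop
  -- `V` is the iterate.
  set V : ℕ → Ω → S → A → ℝ := fun i ω => (qIter M β zmin zmax (fun j => η j ω)
    (fun j => s j ω) (fun j => a j ω) (fun j => s' j ω) i).getD 0 with hV
  have hVm : ∀ i x b, Measurable[history η s a s' i] fun ω => V i ω x b := fun i =>
    (measurable_qIter M β zmin zmax i).2
  have hvis : ∀ i x b, MeasurableSet[history η s a s' i] {ω | s i ω = x ∧ a i ω = b} :=
    fun i x b => MeasurableSet.inter (measurable_state_history i (t := {x}) trivial)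
      (measurable_action_history i (t := {b}) trivial)
  have hin : ∀ i x b x', MeasurableSet[history η s a s' i]
      {ω | tdResidual M (V i ω) x b x' ∈ Set.Icc zmin zmax} := fun i x b x' =>
    measurable_tdResidual (hVm i) x b x' measurableSet_Icc
  have hnoise : ∀ᵐ ω ∂P, ∀ x : S, x ≠ M.sink → ∀ b x', ∃ N,
      Tendsto (fun i => ∑ j ∈ Finset.range i,
        noiseCoeff M β zmin zmax (η j ω) (V j ω) (s j ω) (a j ω) x b x' *
          ((if s' j ω = x' then 1 else 0) - M.p (s j ω) (a j ω) x')) atTop (𝓝 N) := by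
    refine ae_all_iff.2 fun x => ?_
    by_cases hx : x = M.sink
    · exact Eventually.of_forall fun ω hne => absurd hx hne
    refine (ae_all_iff.2 fun b => ae_all_iff.2 fun x' => ?_).mono fun ω hω _ => hω
    have := h.ae_tendsto_noise x' (c := fun i ω =>
      noiseCoeff M β zmin zmax (η i ω) (V i ω) (s i ω) (a i ω) x b x') (fun i => ?_) ?_
    · convert this
    · refine Measurable.ite (MeasurableSet.inter (hvis i x b) (hin i x b x')) ?_ measurable_const
      exact (measurable_step_history i).mul (Real.measurable_exp.comp
        (measurable_const.mul (measurable_tdResidual (hVm i) x b x')))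
    · filter_upwards [hRM] with ω hω
      exact Summable.of_nonneg_of_le (fun i => sq_nonneg _)
        (fun i => noiseCoeff_sq_le M hβ zmin zmax _ _ _ _ x b x')
        ((hω.2 x hx b).2.mul_left _)
  -- A run that never stops constrains only sampled residuals. If a bad residual towards `x'` were
  -- available infinitely often, `x'` would be sampled at such a time.
  have hBC : ∀ᵐ ω ∂P, ∀ x b x', 0 < M.p x b x' →
      (∀ i, (s i ω = x ∧ a i ω = b) ∧ tdResidual M (V i ω) x b x' ∉ Set.Icc zmin zmax →
        s' i ω ≠ x') →
      ∀ᶠ i in atTop, ¬ ((s i ω = x ∧ a i ω = b) ∧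
        tdResidual M (V i ω) x b x' ∉ Set.Icc zmin zmax) := by
    refine ae_all_iff.2 fun x => ae_all_iff.2 fun b => ae_all_iff.2 fun x' => ?_
    by_cases hp : 0 < M.p x b x'
    · refine (h.ae_eventually_notMem hp (D := fun i => {ω | s i ω = x ∧ a i ω = b} ∩
        {ω | tdResidual M (V i ω) x b x' ∈ Set.Icc zmin zmax}ᶜ) (fun i => ?_)
        fun i ω hω => hω.1).mono fun ω hω _ => hω
      exact MeasurableSet.inter (hvis i x b) (hin i x b x').compl
    · exact Eventually.of_forall fun ω h => absurd h hp
  filter_upwards [hRM, h.ae_pos, hnoise, hBC] with ω h1 h2 h3 h4 q hq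
  have hVq : ∀ i, V i ω = q i := fun i => by simp only [hV, hq i, Option.getD_some]
  simp only [hVq] at h3 h4
  refine exists_tendsto_of_run hM hβ hq h1.1 (by convert h1.2) h2 (fun x b x' hp => ?_) h3
  refine (h4 x b x' hp fun i hi hs' => ?_).mono fun i hi hs ha => ?_
  · have := (qIter_succ_of_some (hq i) (hq (i + 1))).1
    simp only [hi.1.1, hi.1.2, hs'] at this
    exact hi.2 this
  · by_contra hno
    exact hi ⟨⟨hs, ha⟩, hno⟩

/-- Almost surely, every run converges and its limit estimates `h⋆`. -/
theorem ae_exists_runConverges (hM : Transient M) (α : ℝ) (h : IsSampleStream M P η s a s')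
    (hRM : RobbinsMonro M P η s a) {β : ℝ} (hβ : 0 < β) (zmin zmax : ℝ)
    (hres : hStar M α β ≠ ⊥ → ∀ᵐ ω ∂P, ∀ i : ℕ, ∀ q : S → A → ℝ,
      qIter M β zmin zmax (fun j => η j ω) (fun j => s j ω) (fun j => a j ω)
        (fun j => s' j ω) i = some q →
      tdResidual M q (s i ω) (a i ω) (s' i ω) ∈ Set.Icc zmin zmax) :
    ∀ᵐ ω ∂P, ∃ Q : Option (S → A → ℝ),
      RunConverges (qIter M β zmin zmax (fun j => η j ω) (fun j => s j ω) (fun j => a j ω)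
        (fun j => s' j ω)) Q ∧
      hEst M α β Q = hStar M α β ∧
      ∀ π, hStar M α β ≠ ⊥ → Greedy Q π → hVal M α π β = hStar M α β := by
  have hres' : ∀ᵐ ω ∂P, hStar M α β ≠ ⊥ → ∀ i : ℕ, ∀ q : S → A → ℝ,
      qIter M β zmin zmax (fun j => η j ω) (fun j => s j ω) (fun j => a j ω)
        (fun j => s' j ω) i = some q →
      tdResidual M q (s i ω) (a i ω) (s' i ω) ∈ Set.Icc zmin zmax := by
    by_cases hbot : hStar M α β = ⊥
    · exact Eventually.of_forall fun ω hne => absurd hbot hne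
    · exact (hres hbot).mono fun ω hω _ => hω
  filter_upwards [hres', ae_exists_tendsto_of_run hM h hRM hβ zmin zmax] with ω h1 h2
  set R := qIter M β zmin zmax (fun j => η j ω) (fun j => s j ω) (fun j => a j ω)
    (fun j => s' j ω) with hR
  by_cases hrun : ∀ i, ∃ q, R i = some q
  · choose q hq using hrun
    obtain ⟨q', hlim, hsink, hfix⟩ := h2 q hq
    have hstar := hEst_eq_hStar (α := α) hM hβ hsink hfix
    exact ⟨some q', ⟨q, hq, hlim⟩, hstar, fun π _ hπ =>
      (hVal_eq_hEst_of_greedy hM hβ hsink hfix hπ).trans hstar⟩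
  · have hbot : hStar M α β = ⊥ := by
      by_contra hne
      refine hrun fun i => ?_
      induction i with
      | zero => exact ⟨_, rfl⟩
      | succ i ih =>
        obtain ⟨q, hq⟩ := ih
        rw [hR, qIter, ← hR, hq, qStep]
        exact ⟨_, if_pos (h1 hne i q hq)⟩
    refine ⟨none, ?_, hbot.symm, fun π hne => absurd hbot hne⟩
    push Not at hrun
    obtain ⟨i, hi⟩ := hrun
    refine eventually_atTop.2 ⟨i, fun j hj => ?_⟩
    induction j, hj using Nat.le_induction with
    | base => exact Option.eq_none_iff_forall_ne_some.2 hi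
    | succ j hj ih => rw [hR, qIter, ← hR, ih, qStep]

end Convergence

/-! ### Stability of the output under convergence. -/

section Output

variable {S A : Type*}

theorem continuous_maxQ [Fintype A] [Nonempty A] (s : S) : Continuous fun q : S → A → ℝ => maxQ q s :=
  Continuous.finset_sup'_apply _ fun a _ => by fun_prop

variable [Fintype S] [Fintype A]

theorem RunConverges.eventually_greedy {run : ℕ → Option (S → A → ℝ)}
    {Q : Option (S → A → ℝ)} (h : RunConverges run Q) :
    ∀ᶠ i in atTop, ∀ π, Greedy (run i) π → Greedy Q π := by
  cases Q with
  | none => exact Eventually.of_forall fun _ _ _ => trivial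
  | some q =>
    obtain ⟨qs, hqs, hlim⟩ := h
    have hlim' : ∀ s a, Tendsto (fun i => qs i s a) atTop (𝓝 (q s a)) := fun s a =>
      tendsto_pi_nhds.1 (tendsto_pi_nhds.1 hlim s) a
    have h : ∀ᶠ i in atTop, ∀ s a b, q s b < q s a → qs i s b < qs i s a := by
      simp only [eventually_all]
      intro s a b hab
      exact (hlim' s b).eventually_lt (hlim' s a) hab
    filter_upwards [h] with i hi π hπ s a
    rw [hqs] at hπ
    by_contra! hlt
    exact (hi s a (π s) hlt).not_ge (hπ s a)

variable [Nonempty A]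

theorem RunConverges.tendsto_hEst {run : ℕ → Option (S → A → ℝ)} {Q : Option (S → A → ℝ)}
    (h : RunConverges run Q) (M : MDP S A) (α β : ℝ) :
    Tendsto (fun i => hEst M α β (run i)) atTop (𝓝 (hEst M α β Q)) := by
  cases Q with
  | none => exact tendsto_const_nhds.congr' (h.mono fun i hi => by simp only [hi])
  | some q =>
    obtain ⟨qs, hqs, hlim⟩ := h
    simp only [hqs, hEst]
    refine (continuous_coe_real_ereal.tendsto _).comp (Tendsto.add_const _ ?_)
    have hpos : 0 < ∑ x, M.μ x * Real.exp (-β * maxQ q x) := by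
      obtain ⟨x, -, hx⟩ : ∃ x ∈ Finset.univ, 0 < M.μ x :=
        Finset.exists_lt_of_sum_lt (f := fun _ => (0 : ℝ)) (by simp [M.μ_sum])
      exact Finset.sum_pos' (fun x _ => mul_nonneg (M.μ_nonneg x) (Real.exp_pos _).le)
        ⟨x, Finset.mem_univ x, mul_pos hx (Real.exp_pos _)⟩
    have hc : Continuous fun q : S → A → ℝ => ∑ x, M.μ x * Real.exp (-β * maxQ q x) :=
      continuous_finsetSum _ fun x _ => continuous_const.mul
        (Real.continuous_exp.comp (continuous_const.mul (continuous_maxQ x)))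
    exact (((hc.tendsto q).comp hlim).log hpos.ne').const_mul _

/-- Strict inequalities between limits persist for late iterates; hence non-maximal levels and
non-greedy actions are eventually excluded, whatever the tie-breaking. -/
theorem eventually_evarOutput (M : MDP S A) (α : ℝ) (B : Finset ℝ)
    {run : ℝ → ℕ → Option (S → A → ℝ)} {Q : ℝ → Option (S → A → ℝ)}
    (h : ∀ β ∈ B, RunConverges (run β) (Q β)) :
    ∀ᶠ i in atTop, ∀ π, EvarOutput M α B (fun β => run β i) π → EvarOutput M α B Q π := by
  have h1 : ∀ᶠ i in atTop, ∀ β ∈ B, ∀ π, Greedy (run β i) π → Greedy (Q β) π :=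
    (eventually_all_finset B).2 fun β hβ => (h β hβ).eventually_greedy
  have h2 : ∀ᶠ i in atTop, ∀ β ∈ B, ∀ β' ∈ B, hEst M α β (Q β) < hEst M α β' (Q β') →
      hEst M α β (run β i) < hEst M α β' (run β' i) := by
    refine (eventually_all_finset B).2 fun β hβ => (eventually_all_finset B).2 fun β' hβ' => ?_
    by_cases hlt : hEst M α β (Q β) < hEst M α β' (Q β')
    · exact (((h β hβ).tendsto_hEst M α β).eventually_lt ((h β' hβ').tendsto_hEst M α β')
        hlt).mono fun i hi _ => hi
    · exact Eventually.of_forall fun i hi => absurd hi hlt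
  filter_upwards [h1, h2] with i hi1 hi2 π
  rintro ⟨β, hβ, hmax, hπ⟩
  refine ⟨β, hβ, fun β' hβ' => ?_, hi1 β hβ π hπ⟩
  by_contra! hlt
  exact (hi2 β hβ β' hβ' hlt).not_ge (hmax β' hβ')

end Output

end TRC

/-! ### Main theorem. -/

theorem mainTheorem2 {S A : Type*} [Fintype S] [DecidableEq S] [Fintype A] [Nonempty A]
    (M : TRC.MDP S A) (hM : TRC.Transient M)
    (α : ℝ) (hα₀ : 0 < α) (hα₁ : α < 1) (δ : ℝ) (hδ : 0 < δ) :
    ∃ βbar : ℝ, 0 < βbar ∧ ∀ β₀ : ℝ, 0 < β₀ → β₀ ≤ βbar →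
      ∀ {Ω : Type*} [MeasurableSpace Ω] (P : Measure Ω) [IsProbabilityMeasure P]
        (η : ℕ → Ω → ℝ) (s : ℕ → Ω → S) (a : ℕ → Ω → A) (s' : ℕ → Ω → S)
        (zmin zmax : ℝ → ℝ),
        TRC.IsSampleStream M P η s a s' →
        TRC.RobbinsMonro M P η s a →
        (∀ β ∈ TRC.grid α δ β₀, TRC.hStar M α β ≠ ⊥ →
          ∀ᵐ ω ∂P, ∀ i : ℕ, ∀ q : S → A → ℝ,
            TRC.qIter M β (zmin β) (zmax β) (fun j => η j ω) (fun j => s j ω)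
              (fun j => a j ω) (fun j => s' j ω) i = some q →
            TRC.tdResidual M q (s i ω) (a i ω) (s' i ω) ∈ Set.Icc (zmin β) (zmax β)) →
        ∀ᵐ ω ∂P, ∃ Q : ℝ → Option (S → A → ℝ),
          (∀ β ∈ TRC.grid α δ β₀,
            TRC.RunConverges
              (TRC.qIter M β (zmin β) (zmax β) (fun j => η j ω) (fun j => s j ω)
                (fun j => a j ω) (fun j => s' j ω)) (Q β) ∧
            TRC.hEst M α β (Q β) = TRC.hStar M α β) ∧
          (∀ π : S → A, TRC.EvarOutput M α (TRC.grid α δ β₀) Q π →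
            TRC.DeltaOptimal M α δ π) ∧
          ∀ᶠ i in atTop, ∀ π : S → A,
            TRC.EvarOutput M α (TRC.grid α δ β₀)
              (fun β => TRC.qIter M β (zmin β) (zmax β) (fun j => η j ω) (fun j => s j ω)
                (fun j => a j ω) (fun j => s' j ω) i) π →
            TRC.DeltaOptimal M α δ π := by
  obtain ⟨βbar, hpos, hbar⟩ := TRC.exists_grid_deltaOptimal hM hα₀ hα₁ hδ
  refine ⟨βbar, hpos, fun β₀ hβ₀ hle Ω _ P _ η s a s' zmin zmax hstream hRM hres => ?_⟩
  have key := (ae_ball_iff (TRC.grid α δ β₀).countable_toSet).2 fun β hβ =>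
    TRC.ae_exists_runConverges hM α hstream hRM (TRC.pos_of_mem_grid hα₀ hα₁ hδ hβ₀ hβ)
      (zmin β) (zmax β) (hres β hβ)
  filter_upwards [key] with ω hω
  choose! Q hQ using hω
  have hout : ∀ π : S → A, TRC.EvarOutput M α (TRC.grid α δ β₀) Q π →
      TRC.DeltaOptimal M α δ π := by
    rintro π ⟨β, hβ, hmax, hπ⟩
    have hmax' : ∀ β' ∈ TRC.grid α δ β₀, TRC.hStar M α β' ≤ TRC.hStar M α β := by
      intro β' hβ'
      rw [← (hQ β' hβ').2.1, ← (hQ β hβ).2.1]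
      exact hmax β' hβ'
    obtain ⟨hne, hopt⟩ := hbar β₀ hβ₀ hle β hβ hmax'
    -- The grid maximum of `h⋆` is finite, so the chosen run did not stop and greediness carries
    -- information.
    exact hopt π ((hQ β hβ).2.2 π (hne ⟨π⟩) hπ)
  refine ⟨Q, fun β hβ => ⟨(hQ β hβ).1, (hQ β hβ).2.1⟩, hout, ?_⟩
  filter_upwards [TRC.eventually_evarOutput M α (TRC.grid α δ β₀) fun β hβ => (hQ β hβ).1]
    with i hi π hπ
  exact hout π (hi π hπ)
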